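/- For each sample size $n$ let $G_n\le n$ be the number of groups, with $G_n\to\infty$; let $m_{g}=m_{n,g}\ge 1$ be the group sizes, and let $X_g=X_{n,g}$ ($1\le g\le G_n$) be real $n\times m_{g}$ design matrices of full column rank that are block orthogonal, i.e. $X_g^{\mathrm T}X_h=0$ for $g\ne h$. The data are $y=\sum_{g}X_g\beta_g^0+\epsilon\sim\mathcal N_n\big(\sum_g X_g\beta^0_g,\sigma^2 I_n\big)$ with $\sigma^2>0$ fixed and known. Put $Q_{n,g}=X_g^{\mathrm T}X_g/n$, $\widehat\beta_g=(X_g^{\mathrm T}X_g)^{-1}X_g^{\mathrm T}y$, $\mathcal A_n=\{g:\beta_g^0\ne 0\}$ (the active groups) and $G_{A_n}=|\mathcal A_n|$. Prior: independently over $g$, $\beta_g\mid\lambda_g^2,\sigma^2,\tau^2\sim\mathcal N_{m_g}\big(0,\lambda_g^2\sigma^2\tau^2(X_g^{\mathrm T}X_g)^{-1}\big)$, where $\lambda_g^2$ has a proper density on $(0,\infty)$ proportional to $t^{-a-1}L(t)$, with $a\ge\frac12$ and $L:(0,\infty)\to(0,\infty)$ measurable and slowly varying at infinity. Assumption 1: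 there are $c_0,t_0>0$ with $L(t)\ge c_0$ for all $t\ge t_0$, and $\sup_{t>0}L(t)<\infty$. Put $\kappa_g=1/(1+\lambda_g^2\tau^2)$. For constants $c_1\ge2$, $c_2\ge1$, define the modified empirical Bayes estimate $\widehat\tau^{\mathrm{EB}}$ by $$(\widehat\tau^{\mathrm{EB}})^{1/2}=\max\Big\{\frac1{G_n},\ \frac1{c_2G_n}\sum_{g=1}^{G_n}\mathbf 1\Big(\frac{n\widehat\beta_g^{\mathrm T}Q_{n,g}\widehat\beta_g}{\sigma^2}>c_1\log G_n\Big)\Big\}.$$ The half-thresholding rule declares group $g$ active if $E(1-\kappa_g\mid\widehat\tau^{\mathrm{EB}},\sigma^2,y)>\frac12$, the posterior expectation for fixed $\tau$ being evaluated at $\tau=\widehat\tau^{\mathrm{EB}}$. The corresponding estimator $\widehat\beta^{\mathrm{HT}}_{g}$ is the posterior mean of $\beta_g$ (at $\tau=\widehat\tau^{\mathrm{EB}}$) if group $g$ is declared active, and $0$ otherwise. Let $\widehat{\mathcal A}_n=\{g:\widehat\beta^{\mathrm{HT}}_g\neq0\}$. Assume Assumption 1 and (A1) there is $C_1>0$,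 not depending on $n$ or $g$, such that the smallest eigenvalue of $Q_{n,g}$ exceeds $C_1$ for every $n$ and every active group $g$; (A2) there are $0\le b<\frac12$ and $C>0$ such that $\min_j|\beta^0_{gj}|>Cn^{-b}$ for every $n$ and every active group $g$; (A3) $\sup_n\max_{g}m_{n,g}<\infty$; and $G_{A_n}=O(G_n^{\epsilon})$ for some $0<\epsilon<\frac12$. Then $$\lim_{n\to\infty}P(\mathcal A_n=\widehat{\mathcal A}_n)=1,$$ and the same holds when $\widehat{\mathcal A}_n$ is replaced by the set of groups declared active by the rule. -/

import Mathlib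

open MeasureTheory ProbabilityTheory Filter Topology Asymptotics

namespace GroupHT

noncomputable section

/-! ### The local shrinkage prior -/

/-- Karamata's slow variation at infinity, for a function on the positive half line. -/
def SlowlyVarying (L : ℝ → ℝ) : Prop :=
  ∀ α : ℝ, 0 < α → Tendsto (fun x : ℝ => L (α * x) / L x) atTop (𝓝 1)

/-- The unnormalised prior density `t ↦ t ^ (-a - 1) * L t` of a squared local parameter. -/
def localKernel (a : ℝ) (L : ℝ → ℝ) (t : ℝ) : ℝ := t ^ (-a - 1) * L t

/-- The standing conditions on `L : (0, ∞) → (0, ∞)` (only the values of `L` on `(0, ∞)` matter):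
positive, measurable, slowly varying, and such that `t ^ (-a - 1) * L t` can be normalised to a
probability density on `(0, ∞)`. -/
structure IsPolynomialTailed (a : ℝ) (L : ℝ → ℝ) : Prop where
  pos : ∀ t : ℝ, 0 < t → 0 < L t
  measurable : Measurable ((Set.Ioi (0 : ℝ)).domRestrict L)
  slowlyVarying : SlowlyVarying L
  integrable : IntegrableOn (localKernel a L) (Set.Ioi 0)

/-- `L` is eventually bounded below by a positive constant, and bounded above on `(0, ∞)`. -/
structure SatisfiesAssumption1 (L : ℝ → ℝ) : Prop where
  lower : ∃ c₀ : ℝ, 0 < c₀ ∧ ∃ t₀ : ℝ, 0 < t₀ ∧ ∀ t : ℝ, t₀ ≤ t → c₀ ≤ L t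
  upper : ∃ M : ℝ, 0 < M ∧ ∀ t : ℝ, 0 < t → L t ≤ M

/-- The prior law of each `λ_g ^ 2`, with density `K * t ^ (-a - 1) * L t` on `(0, ∞)`, where `K`
is the normalising constant. -/
def localPrior (a : ℝ) (L : ℝ → ℝ) : Measure ℝ :=
  (volume.restrict (Set.Ioi (0 : ℝ))).withDensity fun t =>
    ENNReal.ofReal ((∫ s in Set.Ioi (0 : ℝ), localKernel a L s)⁻¹ * localKernel a L t)

/-! ### The grouped linear model -/

section Model

variable {n G : ℕ} {m : Fin G → ℕ}

/-- The mean vector `X β = ∑ g, X_g β_g`. -/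
def linearPredictor (X : ∀ g, Matrix (Fin n) (Fin (m g)) ℝ)
    (β : ∀ g, EuclideanSpace ℝ (Fin (m g))) : EuclideanSpace ℝ (Fin n) :=
  ∑ g, WithLp.toLp 2 (Matrix.mulVec (X g) (WithLp.ofLp (β g)))

/-- Every `X_g` has full column rank. -/
def FullRank (X : ∀ g, Matrix (Fin n) (Fin (m g)) ℝ) : Prop :=
  ∀ g, (X g).rank = m g

/-- The design is block orthogonal: `X_gᵀ X_h = 0` for `g ≠ h`. -/
def BlockOrthogonal (X : ∀ g, Matrix (Fin n) (Fin (m g)) ℝ) : Prop :=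
  ∀ g h, g ≠ h → (X g).transpose * X h = 0

/-- `Q_{n,g} = X_gᵀ X_g / n`. -/
def gramQ (X : ∀ g, Matrix (Fin n) (Fin (m g)) ℝ) (g : Fin G) :
    Matrix (Fin (m g)) (Fin (m g)) ℝ :=
  (1 / (n : ℝ)) • ((X g).transpose * X g)

theorem gramQ_isHermitian (X : ∀ g, Matrix (Fin n) (Fin (m g)) ℝ) (g : Fin G) :
    (gramQ X g).IsHermitian := by
  unfold gramQ
  rw [Matrix.IsHermitian, Matrix.conjTranspose_eq_transpose_of_trivial, Matrix.transpose_smul,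
    Matrix.transpose_mul, Matrix.transpose_transpose]

/-- The smallest eigenvalue of a symmetric matrix (of positive size). -/
def minEigenvalue {k : ℕ} {A : Matrix (Fin k) (Fin k) ℝ} (hA : A.IsHermitian) : ℝ :=
  ⨅ j, hA.eigenvalues j

/-- The set of truly active groups. -/
def activeSet (β0 : ∀ g, EuclideanSpace ℝ (Fin (m g))) : Set (Fin G) :=
  {g | β0 g ≠ 0}

/-- The law of the data `y ~ N_n(X β0, σ² I_n)`. -/
def dataLaw (X : ∀ g, Matrix (Fin n) (Fin (m g)) ℝ) (σ : ℝ)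
    (β0 : ∀ g, EuclideanSpace ℝ (Fin (m g))) : Measure (EuclideanSpace ℝ (Fin n)) :=
  multivariateGaussian (linearPredictor X β0) (σ ^ 2 • (1 : Matrix (Fin n) (Fin n) ℝ))

/-! ### The posterior for a fixed global parameter `τ`

The squared local parameters `λ_g ^ 2` are the coordinates of `l`. -/

/-- The likelihood of `β` given the data `y`: the density of `N_n(X β, σ² I_n)` at `y`, up to the
factor `(2 π σ²) ^ (-n / 2)`, which cancels in every posterior expectation. -/
def likelihood (X : ∀ g, Matrix (Fin n) (Fin (m g)) ℝ) (σ : ℝ) (y : EuclideanSpace ℝ (Fin n))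
    (β : ∀ g, EuclideanSpace ℝ (Fin (m g))) : ℝ :=
  Real.exp (-(‖y - linearPredictor X β‖ ^ 2 / (2 * σ ^ 2)))

/-- The conditional prior of `β` given the local parameters: independently over the groups,
`β_g ~ N(0, λ_g² σ² τ² (X_gᵀ X_g)⁻¹)`. -/
def coefPrior (X : ∀ g, Matrix (Fin n) (Fin (m g)) ℝ) (σ τ : ℝ) (l : Fin G → ℝ) :
    Measure (∀ g, EuclideanSpace ℝ (Fin (m g))) :=
  Measure.pi fun g =>
    multivariateGaussian 0 ((l g * σ ^ 2 * τ ^ 2) • ((X g).transpose * X g)⁻¹)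

/-- Bayes' numerator: the prior expectation of `f(λ², β)` times the likelihood, where first
the `λ_g ^ 2` are drawn independently from the local prior and then `β` given them. -/
def bayesIntegral {E : Type*} [NormedAddCommGroup E] [NormedSpace ℝ E] (a : ℝ) (L : ℝ → ℝ)
    (X : ∀ g, Matrix (Fin n) (Fin (m g)) ℝ) (σ τ : ℝ) (y : EuclideanSpace ℝ (Fin n))
    (f : (Fin G → ℝ) → (∀ g, EuclideanSpace ℝ (Fin (m g))) → E) : E :=
  ∫ l, (∫ β, likelihood X σ y β • f l β ∂(coefPrior X σ τ l))
    ∂(Measure.pi fun _ : Fin G => localPrior a L)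

/-- The posterior expectation `E(f(λ², β) | τ, σ², y)`. -/
def posteriorExp {E : Type*} [NormedAddCommGroup E] [NormedSpace ℝ E] (a : ℝ) (L : ℝ → ℝ)
    (X : ∀ g, Matrix (Fin n) (Fin (m g)) ℝ) (σ τ : ℝ) (y : EuclideanSpace ℝ (Fin n))
    (f : (Fin G → ℝ) → (∀ g, EuclideanSpace ℝ (Fin (m g))) → E) : E :=
  (bayesIntegral a L X σ τ y fun _ _ => (1 : ℝ))⁻¹ • bayesIntegral a L X σ τ y f

/-- The shrinkage coefficient `κ_g = 1 / (1 + λ_g² τ²)`. -/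
def kappa (τ : ℝ) (l : Fin G → ℝ) (g : Fin G) : ℝ := 1 / (1 + l g * τ ^ 2)

/-- The posterior shrinkage weight `E(1 - κ_g | τ, σ², y)`. -/
def shrinkageWeight (a : ℝ) (L : ℝ → ℝ) (X : ∀ g, Matrix (Fin n) (Fin (m g)) ℝ) (σ τ : ℝ)
    (y : EuclideanSpace ℝ (Fin n)) (g : Fin G) : ℝ :=
  posteriorExp a L X σ τ y fun l _ => 1 - kappa τ l g

/-- The posterior mean of `β_g`. -/
def posteriorMean (a : ℝ) (L : ℝ → ℝ) (X : ∀ g, Matrix (Fin n) (Fin (m g)) ℝ) (σ τ : ℝ)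
    (y : EuclideanSpace ℝ (Fin n)) (g : Fin G) : EuclideanSpace ℝ (Fin (m g)) :=
  posteriorExp a L X σ τ y fun _ β => β g

/-! ### The modified empirical Bayes estimate of `τ` and the half-thresholding rule -/

/-- The least squares estimate `(X_gᵀ X_g)⁻¹ X_gᵀ y` of `β_g` (for a block orthogonal design of
full rank this is the block `g` of the joint least squares estimate). -/
def leastSquares (X : ∀ g, Matrix (Fin n) (Fin (m g)) ℝ) (y : EuclideanSpace ℝ (Fin n))
    (g : Fin G) : Fin (m g) → ℝ :=
  Matrix.mulVec ((X g).transpose * X g)⁻¹ (Matrix.mulVec (X g).transpose (WithLp.ofLp y))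

/-- The statistic `n β̂_gᵀ Q_{n,g} β̂_g / σ²`. -/
def groupStatistic (X : ∀ g, Matrix (Fin n) (Fin (m g)) ℝ) (σ : ℝ)
    (y : EuclideanSpace ℝ (Fin n)) (g : Fin G) : ℝ :=
  (n : ℝ) * dotProduct (leastSquares X y g) (Matrix.mulVec (gramQ X g) (leastSquares X y g))
    / σ ^ 2

open Classical in
/-- The modified empirical Bayes estimate of `τ`: its square root is the maximum of `1 / G` and
`1 / (c₂ G)` times the number of groups whose statistic exceeds `c₁ log G`. -/
def tauEB (X : ∀ g, Matrix (Fin n) (Fin (m g)) ℝ) (σ c₁ c₂ : ℝ)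
    (y : EuclideanSpace ℝ (Fin n)) : ℝ :=
  (max (1 / (G : ℝ)) (1 / (c₂ * (G : ℝ)) *
    ∑ g, if c₁ * Real.log (G : ℝ) < groupStatistic X σ y g then (1 : ℝ) else 0)) ^ 2

/-- The groups that the empirical Bayes half-thresholding rule considers active: the posterior
shrinkage weight, evaluated at `τ = τ̂`, exceeds one half. -/
def declaredActive (a : ℝ) (L : ℝ → ℝ) (X : ∀ g, Matrix (Fin n) (Fin (m g)) ℝ) (σ c₁ c₂ : ℝ)
    (y : EuclideanSpace ℝ (Fin n)) : Set (Fin G) :=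
  {g | 1 / 2 < shrinkageWeight a L X σ (tauEB X σ c₁ c₂ y) y g}

open Classical in
/-- The empirical Bayes half-thresholding estimator of `β_g`. -/
def htEstimator (a : ℝ) (L : ℝ → ℝ) (X : ∀ g, Matrix (Fin n) (Fin (m g)) ℝ) (σ c₁ c₂ : ℝ)
    (y : EuclideanSpace ℝ (Fin n)) (g : Fin G) : EuclideanSpace ℝ (Fin (m g)) :=
  if g ∈ declaredActive a L X σ c₁ c₂ y then
    posteriorMean a L X σ (tauEB X σ c₁ c₂ y) y g
  else 0

/-- The set of groups with nonzero half-thresholding estimate. -/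
def selectedSet (a : ℝ) (L : ℝ → ℝ) (X : ∀ g, Matrix (Fin n) (Fin (m g)) ℝ) (σ c₁ c₂ : ℝ)
    (y : EuclideanSpace ℝ (Fin n)) : Set (Fin G) :=
  {g | htEstimator a L X σ c₁ c₂ y g ≠ 0}

end Model

end

end GroupHT

/-! Block orthogonality makes the residual sum of squares split over groups, so likelihood and prior
factor and the posterior weight of group `g` depends on the data only through its statistic `S`, the
squared norm of the standardized score. With `κ = 1 / (1 + tτ²)`, that weight is a ratio of
one-dimensional integrals of `κ^(k/2) exp(-Sκ/2)` against the local prior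
(`shrinkageWeight_eq_groupWeight`). Two bounds, uniform over group sizes at most `s` and `0 < τ ≤
1`, carry the argument: weight ≤ `Cu * exp(S/2) * τ^(2θ)` for a fixed `θ < a`, `θ ≤ 1`
(`exists_groupWeight_le`); weight ≥ `3/4 - Cl * exp(-S/16) * τ^(-2a)` (`exists_le_groupWeight`).

The score is signal plus noise, and the noise in each group is exactly standard Gaussian. A Chernoff
bound with exponent `η < 1/2` and a union bound keep all squared noise norms below `2d log G`, for
some `d > 1`. Markov's inequality keeps the number of noise exceedances of `2 log G` below `G^e`,
where `ε < e < 1/2`. Independence between groups is never needed.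

On this event the estimate satisfies `G^(-2) ≤ τ ≤ const * G^(2e-2)`, since active groups add only
`O(G^ε)` exceedances. For an inactive group the upper bound is then of order `G^(d - 4θ(1-e))`,
which vanishes for a suitable `d > 1` exactly when `4θ(1-e) > 1`; with `θ` close to `1/2 ≤ a` this
is possible because `e < 1/2`. For an active group (A1) and (A2) give a statistic at least of order
`n^(1-2b)`, and its exponential beats `τ^(-2a) ≤ G^(4a) ≤ n^(4a)`. So the weights fall on the
correct sides of `1/2` (`selection_eq_activeSet`).

The posterior mean is the weight times the least squares estimate, hence nonzero for every declared
group on this event, and both versions of the selected set agree. -/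

namespace GroupHT

/-! ### The local prior: fractional moments and mass far out in the tail. -/

section LocalPrior

variable {a : ℝ} {L : ℝ → ℝ}

theorem IsPolynomialTailed.localKernel_pos (hL : IsPolynomialTailed a L) {t : ℝ} (ht : 0 < t) :
    0 < localKernel a L t :=
  mul_pos (Real.rpow_pos_of_pos ht _) (hL.pos t ht)

theorem IsPolynomialTailed.normalizer_pos (hL : IsPolynomialTailed a L) :
    0 < ∫ s in Set.Ioi (0 : ℝ), localKernel a L s := by
  rw [setIntegral_pos_iff_support_of_nonneg_ae _ hL.integrable]
  · have : Set.Ioi (0 : ℝ) ⊆ Function.support (localKernel a L) ∩ Set.Ioi 0 :=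
      fun t ht => ⟨(hL.localKernel_pos ht).ne', ht⟩
    refine lt_of_lt_of_le ?_ (measure_mono this)
    simp
  · filter_upwards [ae_restrict_mem measurableSet_Ioi] with t ht
    exact (hL.localKernel_pos ht).le

theorem IsPolynomialTailed.aemeasurable_density (hL : IsPolynomialTailed a L) :
    AEMeasurable (fun t => ENNReal.ofReal
      ((∫ s in Set.Ioi (0 : ℝ), localKernel a L s)⁻¹ * localKernel a L t))
      (volume.restrict (Set.Ioi (0 : ℝ))) :=
  ((hL.integrable.aestronglyMeasurable.aemeasurable).const_mul _).ennreal_ofReal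

theorem isProbabilityMeasure_localPrior (hL : IsPolynomialTailed a L) :
    IsProbabilityMeasure (localPrior a L) := by
  constructor
  have h0 : ∀ᵐ t ∂volume.restrict (Set.Ioi (0 : ℝ)),
      0 ≤ (∫ s in Set.Ioi (0 : ℝ), localKernel a L s)⁻¹ * localKernel a L t := by
    filter_upwards [ae_restrict_mem measurableSet_Ioi] with t ht
    exact mul_nonneg (inv_nonneg.2 hL.normalizer_pos.le) (hL.localKernel_pos ht).le
  rw [localPrior, withDensity_apply _ MeasurableSet.univ, Measure.restrict_univ,
    ← ofReal_integral_eq_lintegral_ofReal (hL.integrable.const_mul _) h0, integral_const_mul,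
    inv_mul_cancel₀ hL.normalizer_pos.ne', ENNReal.ofReal_one]

theorem ae_pos_localPrior : ∀ᵐ t ∂localPrior a L, 0 < t :=
  (withDensity_absolutelyContinuous _ _).ae_le (ae_restrict_mem measurableSet_Ioi)

/-- Below 1 the factor `t^θ` is at most 1 and the density itself dominates; above 1 the upper bound
on `L` leaves `t^(θ-a-1)`, integrable because `θ < a`. This moment controls the weight of inactive
groups. -/
theorem integrable_rpow_localPrior (hL : IsPolynomialTailed a L) (hL1 : SatisfiesAssumption1 L)
    {θ : ℝ} (hθ0 : 0 < θ) (hθ : θ < a) : Integrable (fun t : ℝ => t ^ θ) (localPrior a L) := by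
  obtain ⟨M, hM, hLM⟩ := hL1.upper
  rw [localPrior, integrable_withDensity_iff_integrable_smul₀' hL.aemeasurable_density
    (by simp)]
  set Z := ∫ s in Set.Ioi (0 : ℝ), localKernel a L s with hZ
  have hZ0 : 0 < Z := hL.normalizer_pos
  have hmeas : AEStronglyMeasurable
      (fun t => (ENNReal.ofReal (Z⁻¹ * localKernel a L t)).toReal • t ^ θ)
      (volume.restrict (Set.Ioi 0)) :=
    (hL.aemeasurable_density.ennreal_toReal.mul (by fun_prop)).aestronglyMeasurable
  have hval : ∀ t : ℝ, 0 < t →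
      ‖(ENNReal.ofReal (Z⁻¹ * localKernel a L t)).toReal • t ^ θ‖ =
        Z⁻¹ * localKernel a L t * t ^ θ := by
    intro t ht
    have h1 : 0 ≤ Z⁻¹ * localKernel a L t :=
      mul_nonneg (inv_nonneg.2 hZ0.le) (hL.localKernel_pos ht).le
    rw [ENNReal.toReal_ofReal h1, smul_eq_mul, Real.norm_of_nonneg]
    exact mul_nonneg h1 (Real.rpow_nonneg ht.le _)
  change IntegrableOn _ (Set.Ioi 0) volume
  rw [← Set.Ioc_union_Ioi_eq_Ioi (zero_le_one' ℝ)]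
  refine IntegrableOn.union ?_ ?_
  · refine Integrable.mono' (g := fun t => Z⁻¹ * localKernel a L t)
      ((hL.integrable.mono_set Set.Ioc_subset_Ioi_self).const_mul _)
      (hmeas.mono_set Set.Ioc_subset_Ioi_self) ?_
    filter_upwards [ae_restrict_mem measurableSet_Ioc] with t ht
    rw [hval t ht.1]
    exact mul_le_of_le_one_right (mul_nonneg (inv_nonneg.2 hZ0.le) (hL.localKernel_pos ht.1).le)
      (Real.rpow_le_one ht.1.le ht.2 hθ0.le)
  · refine Integrable.mono' (g := fun t => Z⁻¹ * M * t ^ (θ - a - 1))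
      ((integrableOn_Ioi_rpow_of_lt (by linarith) one_pos).const_mul _)
      (hmeas.mono_set (Set.Ioi_subset_Ioi zero_le_one)) ?_
    filter_upwards [ae_restrict_mem measurableSet_Ioi] with t ht
    have ht0 : (0 : ℝ) < t := lt_trans one_pos ht
    rw [hval t ht0, localKernel, show θ - a - 1 = (-a - 1) + θ by ring, Real.rpow_add ht0]
    have h1 := hLM t ht0
    have h2 : (0 : ℝ) ≤ t ^ (-a - 1) := Real.rpow_nonneg ht0.le _
    have h3 : (0 : ℝ) ≤ t ^ θ := Real.rpow_nonneg ht0.le _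
    calc Z⁻¹ * (t ^ (-a - 1) * L t) * t ^ θ ≤ Z⁻¹ * (t ^ (-a - 1) * M) * t ^ θ := by gcongr
      _ = _ := by ring

/-- The interval has length `A`, and past `t₀` the density on it is at least a constant times
`(2A)^(-a-1)`. This is the prior mass available to explain a large signal. -/
theorem exists_localPrior_Icc_ge (hL : IsPolynomialTailed a L) (hL1 : SatisfiesAssumption1 L)
    (ha : 0 < a) : ∃ c : ℝ, 0 < c ∧ ∃ T : ℝ, 0 < T ∧ ∀ A : ℝ, T ≤ A →
      c * A ^ (-a) ≤ (localPrior a L).real (Set.Icc A (2 * A)) := by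
  obtain ⟨c₀, hc₀, t₀, ht₀, hLc⟩ := hL1.lower
  set Z := ∫ s in Set.Ioi (0 : ℝ), localKernel a L s with hZ
  have hZ0 : 0 < Z := hL.normalizer_pos
  have := isProbabilityMeasure_localPrior hL
  refine ⟨Z⁻¹ * c₀ * 2 ^ (-a - 1), by positivity, t₀, ht₀, fun A hA => ?_⟩
  have hA0 : 0 < A := ht₀.trans_le hA
  have hsub : Set.Icc A (2 * A) ⊆ Set.Ioi (0 : ℝ) := fun t ht => hA0.trans_le ht.1
  rw [measureReal_def, ← ENNReal.ofReal_le_iff_le_toReal (measure_ne_top _ _), localPrior,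
    withDensity_apply _ measurableSet_Icc, Measure.restrict_restrict measurableSet_Icc,
    Set.inter_eq_left.2 hsub]
  calc ENNReal.ofReal (Z⁻¹ * c₀ * 2 ^ (-a - 1) * A ^ (-a))
      = ENNReal.ofReal (Z⁻¹ * (c₀ * (2 * A) ^ (-a - 1))) * ENNReal.ofReal (2 * A - A) := by
        rw [← ENNReal.ofReal_mul (by positivity), Real.mul_rpow (by norm_num) hA0.le]
        congr 1
        rw [show 2 * A - A = A by ring, show A ^ (-a) = A ^ (-a - 1) * A by
          rw [Real.rpow_sub_one hA0.ne']; field_simp]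
        ring
    _ = ∫⁻ _ in Set.Icc A (2 * A), ENNReal.ofReal (Z⁻¹ * (c₀ * (2 * A) ^ (-a - 1))) := by
        rw [setLIntegral_const, Real.volume_Icc]
    _ ≤ _ := by
        refine setLIntegral_mono' measurableSet_Icc fun t ht => ENNReal.ofReal_le_ofReal ?_
        have ht0 : 0 < t := hsub ht
        refine mul_le_mul_of_nonneg_left ?_ (inv_nonneg.2 hZ0.le)
        rw [localKernel, mul_comm]
        refine mul_le_mul ?_ (hLc t (hA.trans ht.1)) hc₀.le (Real.rpow_nonneg ht0.le _)
        exact Real.rpow_le_rpow_of_nonpos ht0 ht.2 (by linarith)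

end LocalPrior

end GroupHT

namespace GroupHT

/-! ### One-group posterior weights: upper and lower bounds. -/

noncomputable section

/-- The shrinkage coefficient as a function of one squared local parameter. -/
def shrinkCoef (τ t : ℝ) : ℝ := 1 / (1 + t * τ ^ 2)

/-- The marginal likelihood of a group of size `k` with statistic `S`, as a function of its
squared local parameter, up to a constant factor. -/
def groupMarginal (τ S : ℝ) (k : ℕ) (t : ℝ) : ℝ :=
  √(shrinkCoef τ t) ^ k * Real.exp (-(S * shrinkCoef τ t / 2))

/-- The posterior shrinkage weight of a single group. -/
def groupWeight (ν : Measure ℝ) (τ S : ℝ) (k : ℕ) : ℝ :=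
  (∫ t, groupMarginal τ S k t ∂ν)⁻¹ * ∫ t, groupMarginal τ S k t * (1 - shrinkCoef τ t) ∂ν

section Weight

variable {τ S t : ℝ} {k s : ℕ} {ν : Measure ℝ}

theorem shrinkCoef_pos (ht : 0 < t) : 0 < shrinkCoef τ t := by
  unfold shrinkCoef; positivity

theorem shrinkCoef_le_one (ht : 0 < t) : shrinkCoef τ t ≤ 1 := by
  unfold shrinkCoef
  rw [div_le_one (by positivity)]
  nlinarith [mul_nonneg ht.le (sq_nonneg τ)]

theorem measurable_shrinkCoef : Measurable (shrinkCoef τ) := by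
  unfold shrinkCoef; fun_prop

theorem measurable_groupMarginal : Measurable (groupMarginal τ S k) := by
  have := measurable_shrinkCoef (τ := τ)
  unfold groupMarginal; fun_prop

theorem groupMarginal_pos (ht : 0 < t) : 0 < groupMarginal τ S k t := by
  have := shrinkCoef_pos (τ := τ) ht
  unfold groupMarginal; positivity

theorem sqrt_shrinkCoef_pow_le_one (ht : 0 < t) : √(shrinkCoef τ t) ^ k ≤ 1 :=
  pow_le_one₀ (Real.sqrt_nonneg _) (Real.sqrt_le_one.2 (shrinkCoef_le_one ht))

theorem groupMarginal_le_exp (ht : 0 < t) :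
    groupMarginal τ S k t ≤ Real.exp (-(S * shrinkCoef τ t / 2)) :=
  mul_le_of_le_one_left (Real.exp_pos _).le (sqrt_shrinkCoef_pow_le_one ht)

theorem groupMarginal_le_one (hS : 0 ≤ S) (ht : 0 < t) : groupMarginal τ S k t ≤ 1 := by
  refine (groupMarginal_le_exp ht).trans (Real.exp_le_one_iff.2 ?_)
  have := shrinkCoef_pos (τ := τ) ht
  have : 0 ≤ S * shrinkCoef τ t / 2 := by positivity
  linarith

/-- With `x = τ²t`, the left side is `x / (1 + x) ≤ min x 1 ≤ x^θ`. Interpolating with `θ` is needed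
because the prior may lack a first moment. -/
theorem one_sub_shrinkCoef_le_rpow (ht : 0 < t) (hτ : 0 < τ) {θ : ℝ} (hθ0 : 0 < θ)
    (hθ : θ ≤ 1) : 1 - shrinkCoef τ t ≤ (τ ^ 2) ^ θ * t ^ θ := by
  rw [← Real.mul_rpow (by positivity) ht.le]
  set x := τ ^ 2 * t with hx
  have hx0 : 0 < x := by positivity
  have h1 : 1 - shrinkCoef τ t = x / (1 + x) := by
    unfold shrinkCoef
    rw [show t * τ ^ 2 = x by rw [hx, mul_comm]]
    field_simp; ring
  rw [h1]
  rcases le_total x 1 with h | h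
  · calc x / (1 + x) ≤ x := div_le_self hx0.le (by linarith)
      _ = x ^ (1 : ℝ) := (Real.rpow_one x).symm
      _ ≤ x ^ θ := Real.rpow_le_rpow_of_exponent_ge hx0 h hθ
  · exact ((div_le_one (by linarith)).2 (by linarith)).trans (Real.one_le_rpow h hθ0.le)

theorem integrable_groupMarginal_mul [IsFiniteMeasure ν] (hν : ∀ᵐ t ∂ν, 0 < t) (hS : 0 ≤ S)
    {f : ℝ → ℝ} (hf : Measurable f) (hf1 : ∀ t, 0 < t → |f t| ≤ 1) :
    Integrable (fun t => groupMarginal τ S k t * f t) ν := by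
  refine Integrable.mono' (integrable_const (1 : ℝ))
    (measurable_groupMarginal.mul hf).aestronglyMeasurable ?_
  filter_upwards [hν] with t ht
  rw [Real.norm_eq_abs, abs_mul, abs_of_pos (groupMarginal_pos ht)]
  exact mul_le_one₀ (groupMarginal_le_one hS ht) (abs_nonneg _) (hf1 t ht)

theorem integrable_groupMarginal [IsFiniteMeasure ν] (hν : ∀ᵐ t ∂ν, 0 < t) (hS : 0 ≤ S) :
    Integrable (groupMarginal τ S k) ν := by
  simpa using integrable_groupMarginal_mul (τ := τ) (k := k) hν hS
    (measurable_const (a := (1 : ℝ))) (by simp)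

theorem integral_groupMarginal_pos [IsProbabilityMeasure ν] (hν : ∀ᵐ t ∂ν, 0 < t)
    (hS : 0 ≤ S) : 0 < ∫ t, groupMarginal τ S k t ∂ν := by
  rw [integral_pos_iff_support_of_nonneg_ae _ (integrable_groupMarginal hν hS)]
  · have h : ∀ᵐ t ∂ν, t ∈ Function.support (groupMarginal τ S k) := by
      filter_upwards [hν] with t ht using (groupMarginal_pos ht).ne'
    have h1 : ν (Function.support (groupMarginal τ S k)) = 1 := mem_ae_iff_prob_eq_one
      (measurableSet_support measurable_groupMarginal) |>.1 h
    rw [h1]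
    exact one_pos
  · filter_upwards [hν] with t ht using (groupMarginal_pos ht).le

theorem integrable_groupMarginal_mul_shrinkCoef [IsFiniteMeasure ν] (hν : ∀ᵐ t ∂ν, 0 < t)
    (hS : 0 ≤ S) : Integrable (fun t => groupMarginal τ S k t * shrinkCoef τ t) ν :=
  integrable_groupMarginal_mul hν hS measurable_shrinkCoef fun t ht => by
    rw [abs_of_pos (shrinkCoef_pos ht)]; exact shrinkCoef_le_one ht

/-- The numerator is at most `τ^(2θ)` times the `θ`-moment, as the marginal is at most 1. In the
denominator, `κ ≤ 1` costs a factor `exp(-S/2)`; what remains is smallest at `τ = 1`, `k = s`, which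
gives a constant uniform in both. -/
theorem exists_groupWeight_le [IsProbabilityMeasure ν] (hν : ∀ᵐ t ∂ν, 0 < t) {θ : ℝ}
    (hθ0 : 0 < θ) (hθ1 : θ ≤ 1) (hθ : Integrable (fun t : ℝ => t ^ θ) ν) (s : ℕ) :
    ∃ C : ℝ, 0 < C ∧ ∀ (k : ℕ) (τ S : ℝ), k ≤ s → 0 < τ → τ ≤ 1 → 0 ≤ S →
      groupWeight ν τ S k ≤ C * (Real.exp (S / 2) * (τ ^ 2) ^ θ) := by
  set d := ∫ t, groupMarginal 1 0 s t ∂ν with hd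
  have hd0 : 0 < d := integral_groupMarginal_pos hν le_rfl
  set e := ∫ t, t ^ θ ∂ν with he
  have he0 : 0 ≤ e := integral_nonneg_of_ae (by
    filter_upwards [hν] with t ht using Real.rpow_nonneg ht.le _)
  refine ⟨d⁻¹ * e + 1, by positivity, fun k τ S hk hτ hτ1 hS => ?_⟩
  have hD : Real.exp (-(S / 2)) * d ≤ ∫ t, groupMarginal τ S k t ∂ν := by
    rw [hd, ← integral_const_mul]
    refine integral_mono_ae ((integrable_groupMarginal hν le_rfl).const_mul _)
      (integrable_groupMarginal hν hS) ?_
    filter_upwards [hν] with t ht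
    have h1 : shrinkCoef 1 t ≤ shrinkCoef τ t := by
      unfold shrinkCoef
      apply one_div_le_one_div_of_le (by positivity)
      have : τ ^ 2 ≤ 1 := pow_le_one₀ hτ.le hτ1
      nlinarith
    have h2 : √(shrinkCoef 1 t) ^ s ≤ √(shrinkCoef τ t) ^ k :=
      (pow_le_pow_of_le_one (Real.sqrt_nonneg _)
        (Real.sqrt_le_one.2 (shrinkCoef_le_one ht)) hk).trans
        (pow_le_pow_left₀ (Real.sqrt_nonneg _) (Real.sqrt_le_sqrt h1) _)
    have h3 : Real.exp (-(S / 2)) ≤ Real.exp (-(S * shrinkCoef τ t / 2)) := by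
      apply Real.exp_le_exp.2
      have := mul_le_of_le_one_right hS (shrinkCoef_le_one (τ := τ) ht)
      linarith
    simp only [groupMarginal, zero_mul, zero_div, neg_zero, Real.exp_zero, mul_one]
    rw [mul_comm]
    exact mul_le_mul h2 h3 (Real.exp_pos _).le (by positivity)
  have hN : ∫ t, groupMarginal τ S k t * (1 - shrinkCoef τ t) ∂ν ≤ (τ ^ 2) ^ θ * e := by
    rw [he, ← integral_const_mul]
    refine integral_mono_ae (integrable_groupMarginal_mul hν hS
      (measurable_const.sub measurable_shrinkCoef) fun t ht => ?_) (hθ.const_mul _) ?_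
    · rw [abs_of_nonneg (by linarith [shrinkCoef_le_one (τ := τ) ht])]
      linarith [shrinkCoef_pos (τ := τ) ht]
    · filter_upwards [hν] with t ht
      refine le_trans ?_ (one_sub_shrinkCoef_le_rpow ht hτ hθ0 hθ1)
      exact mul_le_of_le_one_left (by linarith [shrinkCoef_le_one (τ := τ) ht])
        (groupMarginal_le_one hS ht)
  have hτθ : 0 ≤ (τ ^ 2) ^ θ := by positivity
  calc groupWeight ν τ S k
      ≤ (Real.exp (-(S / 2)) * d)⁻¹ * ((τ ^ 2) ^ θ * e) := by
        unfold groupWeight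
        refine mul_le_mul (inv_anti₀ (by positivity) hD) hN ?_ (by positivity)
        refine integral_nonneg_of_ae ?_
        filter_upwards [hν] with t ht
        exact mul_nonneg (groupMarginal_pos ht).le (by linarith [shrinkCoef_le_one (τ := τ) ht])
    _ = d⁻¹ * e * (Real.exp (S / 2) * (τ ^ 2) ^ θ) := by
        rw [mul_inv, ← Real.exp_neg, neg_neg]; ring
    _ ≤ _ := by
        have : 0 ≤ Real.exp (S / 2) * (τ ^ 2) ^ θ := by positivity
        nlinarith

theorem groupWeight_eq_one_sub [IsProbabilityMeasure ν] (hν : ∀ᵐ t ∂ν, 0 < t) (hS : 0 ≤ S) :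
    groupWeight ν τ S k = 1 - (∫ t, groupMarginal τ S k t ∂ν)⁻¹ *
      ∫ t, groupMarginal τ S k t * shrinkCoef τ t ∂ν := by
  have hD := integral_groupMarginal_pos (τ := τ) (k := k) hν hS
  simp only [groupWeight, mul_sub, mul_one]
  rw [integral_sub (integrable_groupMarginal hν hS)
    (integrable_groupMarginal_mul_shrinkCoef hν hS), mul_sub, inv_mul_cancel₀ hD.ne']

/-- The posterior mean of `κ` is bounded by splitting at `κ = 1/4`: the small values contribute at
most `1/4`, the others at most `exp(-S/8)` over the normalizer. Restricting the normalizer to `t` of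
order `τ^(-2)`, where `κ ≤ 1/8`, shows that it is at least a multiple of `exp(-S/16) τ^(2a)`. The
quotient retains `exp(-S/16)`. -/
theorem exists_le_groupWeight [IsProbabilityMeasure ν] (hν : ∀ᵐ t ∂ν, 0 < t) {a c T : ℝ}
    (hc : 0 < c) (hT : ∀ A : ℝ, T ≤ A → c * A ^ (-a) ≤ ν.real (Set.Icc A (2 * A))) (s : ℕ) :
    ∃ C : ℝ, 0 < C ∧ ∀ (k : ℕ) (τ S : ℝ), k ≤ s → 0 < τ → τ ≤ 1 → 0 ≤ S →
      3 / 4 - C * (Real.exp (-(S / 16)) * (τ ^ 2) ^ (-a)) ≤ groupWeight ν τ S k := by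
  -- `B ≥ 7` forces `κ ≤ 1/8` once `tτ² ≥ B`; `B ≥ T` together with `τ ≤ 1` makes the tail bound
  -- applicable at `A = B / τ²`.
  set B := max 7 T with hB
  have hB7 : 7 ≤ B := le_max_left _ _
  have hBT : T ≤ B := le_max_right _ _
  set q := √(1 / (1 + 2 * B)) ^ s with hq
  have hq0 : 0 < q := by positivity
  refine ⟨(q * c * B ^ (-a))⁻¹, by positivity, fun k τ S hk hτ hτ1 hS => ?_⟩
  rw [groupWeight_eq_one_sub hν hS]
  set D := ∫ t, groupMarginal τ S k t ∂ν with hD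
  have hD0 : 0 < D := integral_groupMarginal_pos hν hS
  set A := B / τ ^ 2 with hA
  have hA0 : 0 < A := by positivity
  have hAT : T ≤ A := hBT.trans (le_div_self (by linarith) (by positivity)
    (pow_le_one₀ hτ.le hτ1))
  have hDlow : q * Real.exp (-(S / 16)) * (c * A ^ (-a)) ≤ D := by
    calc q * Real.exp (-(S / 16)) * (c * A ^ (-a))
        ≤ q * Real.exp (-(S / 16)) * ν.real (Set.Icc A (2 * A)) := by
          gcongr; exact hT A hAT
      _ = ∫ _ in Set.Icc A (2 * A), q * Real.exp (-(S / 16)) ∂ν := by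
          rw [setIntegral_const, smul_eq_mul, mul_comm]
      _ ≤ ∫ t in Set.Icc A (2 * A), groupMarginal τ S k t ∂ν := by
          refine setIntegral_mono_on (integrable_const _)
            (integrable_groupMarginal hν hS).integrableOn measurableSet_Icc fun t ht => ?_
          have ht0 : 0 < t := hA0.trans_le ht.1
          have hl : B ≤ t * τ ^ 2 := (div_le_iff₀ (by positivity)).1 ht.1
          have hu : t * τ ^ 2 ≤ 2 * B := by
            have := ht.2
            rw [hA, ← mul_div_assoc, le_div_iff₀ (by positivity)] at this
            exact this
          have h1 : 1 / (1 + 2 * B) ≤ shrinkCoef τ t := by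
            unfold shrinkCoef
            exact one_div_le_one_div_of_le (by linarith) (by linarith)
          have h2 : shrinkCoef τ t ≤ 1 / 8 := by
            unfold shrinkCoef
            exact one_div_le_one_div_of_le (by norm_num) (by linarith)
          have h3 : 1 / (1 + 2 * B) ≤ 1 := (h1.trans h2).trans (by norm_num)
          unfold groupMarginal
          refine mul_le_mul ?_ (Real.exp_le_exp.2 (by nlinarith)) (Real.exp_pos _).le
            (by positivity)
          exact (pow_le_pow_of_le_one (Real.sqrt_nonneg _) (Real.sqrt_le_one.2 h3) hk).trans
            (pow_le_pow_left₀ (Real.sqrt_nonneg _) (Real.sqrt_le_sqrt h1) _)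
      _ ≤ D := by
          refine setIntegral_le_integral (integrable_groupMarginal hν hS) ?_
          filter_upwards [hν] with t ht using (groupMarginal_pos ht).le
  have hN : ∫ t, groupMarginal τ S k t * shrinkCoef τ t ∂ν ≤ D / 4 + Real.exp (-(S / 8)) := by
    have hint := (integrable_groupMarginal (τ := τ) (k := k) hν hS).div_const 4
    calc _ ≤ ∫ t, (groupMarginal τ S k t / 4 + Real.exp (-(S / 8))) ∂ν := by
          refine integral_mono_ae (integrable_groupMarginal_mul_shrinkCoef hν hS)
            (hint.add (integrable_const _)) ?_
          filter_upwards [hν] with t ht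
          have h0 := groupMarginal_pos (τ := τ) (S := S) (k := k) ht
          rcases le_total (shrinkCoef τ t) (1 / 4) with h | h
          · have := mul_le_mul_of_nonneg_left h h0.le
            have := Real.exp_pos (-(S / 8))
            linarith
          · have h1 := mul_le_of_le_one_right h0.le (shrinkCoef_le_one (τ := τ) ht)
            have h2 := groupMarginal_le_exp (τ := τ) (S := S) (k := k) ht
            have h3 : Real.exp (-(S * shrinkCoef τ t / 2)) ≤ Real.exp (-(S / 8)) :=
              Real.exp_le_exp.2 (by nlinarith)
            linarith
      _ = _ := by
          rw [integral_add hint (integrable_const _), integral_div]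
          simp [hD]
  have hfin : D⁻¹ * ∫ t, groupMarginal τ S k t * shrinkCoef τ t ∂ν ≤
      1 / 4 + (q * Real.exp (-(S / 16)) * (c * A ^ (-a)))⁻¹ * Real.exp (-(S / 8)) := by
    calc _ ≤ D⁻¹ * (D / 4 + Real.exp (-(S / 8))) := by gcongr
      _ = 1 / 4 + D⁻¹ * Real.exp (-(S / 8)) := by field_simp
      _ ≤ _ := by gcongr
  have hform : (q * Real.exp (-(S / 16)) * (c * A ^ (-a)))⁻¹ * Real.exp (-(S / 8)) =
      (q * c * B ^ (-a))⁻¹ * (Real.exp (-(S / 16)) * (τ ^ 2) ^ (-a)) := by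
    rw [hA, Real.div_rpow (by linarith) (by positivity),
      show Real.exp (-(S / 8)) = Real.exp (-(S / 16)) * Real.exp (-(S / 16)) by
        rw [← Real.exp_add]; ring_nf]
    have : 0 < (τ ^ 2) ^ (-a) := by positivity
    have : 0 < B ^ (-a) := by positivity
    field_simp
  linarith [hfin.trans_eq (by rw [hform])]

end Weight

end

end GroupHT

namespace GroupHT

open scoped Matrix MatrixOrder

/-! ### Gram matrices, square roots and the smallest eigenvalue. -/

section LinearAlgebra

variable {n k : ℕ}

theorem norm_sq_eq_dotProduct {ι : Type*} [Fintype ι] (x : EuclideanSpace ℝ ι) :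
    ‖x‖ ^ 2 = WithLp.ofLp x ⬝ᵥ WithLp.ofLp x := by
  rw [EuclideanSpace.real_norm_sq_eq]
  simp [dotProduct, sq]

theorem posDef_transpose_mul_self {A : Matrix (Fin n) (Fin k) ℝ} (hA : A.rank = k) :
    (Aᵀ * A).PosDef := by
  rw [← Matrix.conjTranspose_eq_transpose_of_trivial]
  refine Matrix.PosDef.conjTranspose_mul_self A ?_
  have h := LinearMap.finrank_range_add_finrank_ker A.mulVecLin
  have h1 : Module.finrank ℝ (LinearMap.range A.mulVecLin) = k := hA
  rw [h1, Module.finrank_fin_fun] at h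
  have h2 : LinearMap.ker A.mulVecLin = ⊥ := Submodule.finrank_eq_zero.1 (by omega)
  exact LinearMap.ker_eq_bot.1 h2

theorem isUnit_det_transpose_mul_self {A : Matrix (Fin n) (Fin k) ℝ} (hA : A.rank = k) :
    IsUnit (Aᵀ * A).det :=
  (posDef_transpose_mul_self hA).det_pos.ne'.isUnit

/-- For a square root `T` of `w N⁻¹`, conjugation by `T` turns `N` into `w`. -/
theorem sqrt_smul_inv_conj {N T : Matrix (Fin k) (Fin k) ℝ} (hN : IsUnit N.det) {w : ℝ}
    (hw : w ≠ 0) (hT : T * T = w • N⁻¹) : T * N * T = w • (1 : Matrix (Fin k) (Fin k) ℝ) := by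
  have h1 : T * (T * ((1 / w) • N)) = 1 := by
    rw [← mul_assoc, hT, Matrix.mul_smul, Matrix.smul_mul, smul_smul, one_div_mul_cancel hw,
      one_smul, Matrix.nonsing_inv_mul _ hN]
  have h2 := mul_eq_one_comm.1 h1
  rw [Matrix.mul_smul, Matrix.smul_mul] at h2
  rw [← h2, smul_smul, mul_one_div_cancel hw, one_smul]

/-- Rayleigh's inequality, read off coordinate by coordinate in an orthonormal eigenbasis. -/
theorem minEigenvalue_mul_le_dotProduct {A : Matrix (Fin k) (Fin k) ℝ} (hA : A.IsHermitian)
    (x : Fin k → ℝ) : minEigenvalue hA * (x ⬝ᵥ x) ≤ x ⬝ᵥ A *ᵥ x := by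
  set b := hA.eigenvectorBasis with hb
  have hx : ∀ y : Fin k → ℝ, x ⬝ᵥ y =
      ∑ i, (x ⬝ᵥ WithLp.ofLp (b i)) * (WithLp.ofLp (b i) ⬝ᵥ y) := by
    intro y
    have := b.sum_inner_mul_inner (WithLp.toLp 2 x) (WithLp.toLp 2 y)
    simp only [EuclideanSpace.inner_eq_star_dotProduct, star_trivial] at this
    rw [dotProduct_comm x y, ← this]
    refine Finset.sum_congr rfl fun i _ => ?_
    rw [dotProduct_comm x, dotProduct_comm y]
  have hAx : ∀ i, WithLp.ofLp (b i) ⬝ᵥ A *ᵥ x =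
      hA.eigenvalues i * (WithLp.ofLp (b i) ⬝ᵥ x) := by
    intro i
    have h1 := hA.mulVec_eigenvectorBasis i
    have h2 : Aᵀ = A := by
      rw [← Matrix.conjTranspose_eq_transpose_of_trivial]; exact hA
    rw [Matrix.dotProduct_mulVec, ← Matrix.mulVec_transpose, h2, h1, smul_dotProduct]
    simp [hb]
  rw [hx x, hx (A *ᵥ x), Finset.mul_sum]
  refine Finset.sum_le_sum fun i _ => ?_
  rw [hAx, dotProduct_comm x]
  have : minEigenvalue hA ≤ hA.eigenvalues i := ciInf_le (Set.finite_range _).bddBelow i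
  nlinarith [mul_self_nonneg (WithLp.ofLp (b i) ⬝ᵥ x)]

end LinearAlgebra

/-! ### Geometry of the block orthogonal design and the standardized scores. -/

section Model

variable {n G : ℕ} {m : Fin G → ℕ} {X : ∀ g, Matrix (Fin n) (Fin (m g)) ℝ}

theorem ofLp_linearPredictor (β : ∀ g, EuclideanSpace ℝ (Fin (m g))) :
    WithLp.ofLp (linearPredictor X β) = ∑ g, X g *ᵥ WithLp.ofLp (β g) := by
  simp [linearPredictor]

/-- All cross terms vanish; every later use of orthogonality passes through this identity. -/
theorem BlockOrthogonal.transpose_mulVec_sum (hX : BlockOrthogonal X) (g : Fin G)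
    (u : ∀ g, Fin (m g) → ℝ) :
    (X g)ᵀ *ᵥ ∑ h, X h *ᵥ u h = ((X g)ᵀ * X g) *ᵥ u g := by
  rw [Matrix.mulVec_sum, Finset.sum_eq_single g]
  · rw [Matrix.mulVec_mulVec]
  · intro h _ hne
    rw [Matrix.mulVec_mulVec, hX g h hne.symm, Matrix.zero_mulVec]
  · simp

theorem gram_mulVec_leastSquares (hr : FullRank X) (y : EuclideanSpace ℝ (Fin n)) (g : Fin G) :
    ((X g)ᵀ * X g) *ᵥ leastSquares X y g = (X g)ᵀ *ᵥ WithLp.ofLp y := by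
  rw [leastSquares, Matrix.mulVec_mulVec,
    Matrix.mul_nonsing_inv _ (isUnit_det_transpose_mul_self (hr g)), Matrix.one_mulVec]

theorem leastSquares_linearPredictor (hr : FullRank X) (hX : BlockOrthogonal X)
    (β : ∀ g, EuclideanSpace ℝ (Fin (m g))) (g : Fin G) :
    leastSquares X (linearPredictor X β) g = WithLp.ofLp (β g) := by
  rw [leastSquares, ofLp_linearPredictor, hX.transpose_mulVec_sum, Matrix.mulVec_mulVec,
    Matrix.nonsing_inv_mul _ (isUnit_det_transpose_mul_self (hr g)), Matrix.one_mulVec]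

theorem dotProduct_sum_mulVec (v : Fin n → ℝ) (u : ∀ g, Fin (m g) → ℝ) :
    v ⬝ᵥ ∑ g, X g *ᵥ u g = ∑ g, ((X g)ᵀ *ᵥ v) ⬝ᵥ u g := by
  rw [dotProduct_sum]
  simp_rw [Matrix.dotProduct_mulVec, Matrix.mulVec_transpose]

/-- Pythagoras for the residual sum of squares. -/
theorem norm_sub_linearPredictor_sq (hr : FullRank X) (hX : BlockOrthogonal X)
    (y : EuclideanSpace ℝ (Fin n)) (β : ∀ g, EuclideanSpace ℝ (Fin (m g))) :
    ‖y - linearPredictor X β‖ ^ 2 =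
      ‖y - linearPredictor X (fun g => WithLp.toLp 2 (leastSquares X y g))‖ ^ 2 +
      ∑ g, (leastSquares X y g - WithLp.ofLp (β g)) ⬝ᵥ
        ((X g)ᵀ * X g) *ᵥ (leastSquares X y g - WithLp.ofLp (β g)) := by
  set r := WithLp.ofLp y - ∑ g, X g *ᵥ leastSquares X y g with hrdef
  set u : ∀ g, Fin (m g) → ℝ := fun g => leastSquares X y g - WithLp.ofLp (β g) with hu
  have h1 : ∀ g, (X g)ᵀ *ᵥ r = 0 := by
    intro g
    rw [hrdef, Matrix.mulVec_sub, hX.transpose_mulVec_sum, gram_mulVec_leastSquares hr, sub_self]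
  have h2 : WithLp.ofLp y - ∑ g, X g *ᵥ WithLp.ofLp (β g) = r + ∑ g, X g *ᵥ u g := by
    simp only [hrdef, hu, Matrix.mulVec_sub, Finset.sum_sub_distrib]
    abel
  rw [norm_sq_eq_dotProduct, norm_sq_eq_dotProduct, WithLp.ofLp_sub, WithLp.ofLp_sub,
    ofLp_linearPredictor, ofLp_linearPredictor, h2]
  change _ = r ⬝ᵥ r + ∑ g, u g ⬝ᵥ ((X g)ᵀ * X g) *ᵥ u g
  rw [add_dotProduct, dotProduct_add, dotProduct_comm (∑ g, X g *ᵥ u g) (r + _),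
    add_dotProduct, dotProduct_sum_mulVec r, dotProduct_sum_mulVec (∑ g, X g *ᵥ u g)]
  simp_rw [h1, hX.transpose_mulVec_sum]
  simp [dotProduct_comm]

theorem groupStatistic_eq (hn : n ≠ 0) (σ : ℝ) (y : EuclideanSpace ℝ (Fin n)) (g : Fin G) :
    groupStatistic X σ y g =
      leastSquares X y g ⬝ᵥ ((X g)ᵀ * X g) *ᵥ leastSquares X y g / σ ^ 2 := by
  have : (n : ℝ) ≠ 0 := Nat.cast_ne_zero.2 hn
  rw [groupStatistic, gramQ, Matrix.smul_mulVec, dotProduct_smul, smul_eq_mul]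
  field_simp

/-- The standardized least squares estimate `σ⁻¹ (X_gᵀ X_g)^(-1/2) X_gᵀ y`. -/
noncomputable def standardScore (X : ∀ g, Matrix (Fin n) (Fin (m g)) ℝ) (σ : ℝ) (g : Fin G)
    (y : EuclideanSpace ℝ (Fin n)) : EuclideanSpace ℝ (Fin (m g)) :=
  WithLp.toLp 2 ((σ⁻¹ • (CFC.sqrt ((X g)ᵀ * X g)⁻¹ * (X g)ᵀ)) *ᵥ WithLp.ofLp y)

theorem transpose_sqrt {k : ℕ} (A : Matrix (Fin k) (Fin k) ℝ) :
    (CFC.sqrt A)ᵀ = CFC.sqrt A := by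
  rw [← Matrix.conjTranspose_eq_transpose_of_trivial]
  exact (CFC.sqrt_nonneg A).isSelfAdjoint

theorem sqrt_gram_inv_mul_self (hr : FullRank X) (g : Fin G) :
    CFC.sqrt ((X g)ᵀ * X g)⁻¹ * CFC.sqrt ((X g)ᵀ * X g)⁻¹ = ((X g)ᵀ * X g)⁻¹ :=
  CFC.sqrt_mul_sqrt_self _ (posDef_transpose_mul_self (hr g)).inv.posSemidef.nonneg

/-- The rows of `(X_gᵀ X_g)^(-1/2) X_gᵀ` are orthonormal. -/
theorem sqrt_gram_inv_orthonormal (hr : FullRank X) (g : Fin G) :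
    (CFC.sqrt ((X g)ᵀ * X g)⁻¹ * (X g)ᵀ) * (CFC.sqrt ((X g)ᵀ * X g)⁻¹ * (X g)ᵀ)ᵀ = 1 := by
  rw [Matrix.transpose_mul, transpose_sqrt, Matrix.transpose_transpose]
  have := sqrt_smul_inv_conj (isUnit_det_transpose_mul_self (hr g)) one_ne_zero
    (T := CFC.sqrt ((X g)ᵀ * X g)⁻¹) (by rw [one_smul, sqrt_gram_inv_mul_self hr])
  rw [one_smul] at this
  rw [← this]
  simp only [Matrix.mul_assoc]

/-- The score is linear in the data, so this form lets the statistic be split into signal and noise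
by the triangle inequality. -/
theorem groupStatistic_eq_norm_sq (hn : n ≠ 0) (hr : FullRank X) (σ : ℝ)
    (y : EuclideanSpace ℝ (Fin n)) (g : Fin G) :
    groupStatistic X σ y g = ‖standardScore X σ g y‖ ^ 2 := by
  rw [groupStatistic_eq hn, norm_sq_eq_dotProduct, gram_mulVec_leastSquares hr, standardScore]
  simp only [Matrix.smul_mulVec, dotProduct_smul, smul_dotProduct, smul_eq_mul]
  rw [← Matrix.mulVec_mulVec, Matrix.dotProduct_mulVec (_ *ᵥ _), ← Matrix.mulVec_transpose,
    transpose_sqrt, Matrix.mulVec_mulVec, sqrt_gram_inv_mul_self hr]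
  change leastSquares X y g ⬝ᵥ _ / σ ^ 2 = σ⁻¹ * (σ⁻¹ * (leastSquares X y g ⬝ᵥ _))
  rw [div_eq_mul_inv, sq, mul_inv]
  ring

theorem groupStatistic_nonneg (hn : n ≠ 0) (hr : FullRank X) (σ : ℝ)
    (y : EuclideanSpace ℝ (Fin n)) (g : Fin G) : 0 ≤ groupStatistic X σ y g := by
  rw [groupStatistic_eq_norm_sq hn hr]; positivity

theorem standardScore_add (σ : ℝ) (g : Fin G) (y z : EuclideanSpace ℝ (Fin n)) :
    standardScore X σ g (y + z) = standardScore X σ g y + standardScore X σ g z := by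
  simp [standardScore, Matrix.mulVec_add]

theorem norm_standardScore_linearPredictor_sq (hn : n ≠ 0) (hr : FullRank X)
    (hX : BlockOrthogonal X) (σ : ℝ) (β : ∀ g, EuclideanSpace ℝ (Fin (m g))) (g : Fin G) :
    ‖standardScore X σ g (linearPredictor X β)‖ ^ 2 =
      n * (WithLp.ofLp (β g) ⬝ᵥ gramQ X g *ᵥ WithLp.ofLp (β g)) / σ ^ 2 := by
  rw [← groupStatistic_eq_norm_sq hn hr, groupStatistic, leastSquares_linearPredictor hr hX]

theorem standardScore_linearPredictor_of_eq_zero (hn : n ≠ 0) (hr : FullRank X)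
    (hX : BlockOrthogonal X) (σ : ℝ) {β : ∀ g, EuclideanSpace ℝ (Fin (m g))} {g : Fin G}
    (hβ : β g = 0) : standardScore X σ g (linearPredictor X β) = 0 := by
  have := norm_standardScore_linearPredictor_sq hn hr hX σ β g
  rw [hβ] at this
  simpa using this

theorem le_norm_standardScore_linearPredictor_sq (hn : n ≠ 0) (hr : FullRank X)
    (hX : BlockOrthogonal X) (σ : ℝ) {β : ∀ g, EuclideanSpace ℝ (Fin (m g))} {g : Fin G}
    {C₁ d : ℝ} (hC₁ : 0 ≤ C₁) (hd : 0 ≤ d) (hm : 0 < m g)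
    (h1 : C₁ ≤ minEigenvalue (gramQ_isHermitian X g)) (h2 : ∀ j, d ≤ |β g j|) :
    n * (C₁ * d ^ 2) / σ ^ 2 ≤ ‖standardScore X σ g (linearPredictor X β)‖ ^ 2 := by
  rw [norm_standardScore_linearPredictor_sq hn hr hX]
  have h3 : d ^ 2 ≤ WithLp.ofLp (β g) ⬝ᵥ WithLp.ofLp (β g) := by
    -- A single coordinate already gives enough signal; positivity of the group size supplies one.
    have h4 : d ^ 2 ≤ β g ⟨0, hm⟩ * β g ⟨0, hm⟩ := by
      rw [← sq, ← sq_abs (β g _)]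
      exact pow_le_pow_left₀ hd (h2 _) 2
    exact h4.trans (Finset.single_le_sum (f := fun j => β g j * β g j)
      (fun j _ => mul_self_nonneg _) (Finset.mem_univ _))
  have h5 := minEigenvalue_mul_le_dotProduct (gramQ_isHermitian X g) (WithLp.ofLp (β g))
  have h6 : C₁ * d ^ 2 ≤ minEigenvalue (gramQ_isHermitian X g) *
      (WithLp.ofLp (β g) ⬝ᵥ WithLp.ofLp (β g)) :=
    mul_le_mul h1 h3 (sq_nonneg _) (hC₁.trans h1)
  gcongr
  exact h6.trans h5

end Model

end GroupHT

namespace GroupHT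

open scoped Matrix MatrixOrder

/-! ### Gaussian integrals of the likelihood of one group. -/

section Gaussian

/-- Completing the square: tilting `N(0, 1)` by the likelihood gives `N((1-κ)v, κ)` with `κ = 1 / (1
+ p)`, times an explicit mass. The choices `f = 1` and `f = id` give the marginal likelihood and the
posterior mean. -/
theorem integral_exp_mul_gaussianReal {p : ℝ} (hp : 0 < p) (v : ℝ) (f : ℝ → ℝ) :
    ∫ z, Real.exp (-(p * (v - z) ^ 2 / 2)) * f z ∂gaussianReal 0 1 =
      √(1 / (1 + p)) * Real.exp (-(p * v ^ 2 * (1 / (1 + p)) / 2)) *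
        ∫ z, f z ∂gaussianReal ((1 - 1 / (1 + p)) * v) (1 / (1 + p)).toNNReal := by
  have hp1 : 0 < 1 + p := by linarith
  have hκ : 0 < 1 / (1 + p) := by positivity
  have hne : (1 / (1 + p)).toNNReal ≠ 0 := by simpa using hp1
  rw [integral_gaussianReal_eq_integral_smul one_ne_zero,
    integral_gaussianReal_eq_integral_smul hne, ← integral_const_mul]
  refine integral_congr_ae (ae_of_all _ fun z => ?_)
  simp only [gaussianPDFReal, smul_eq_mul, NNReal.coe_one, mul_one, sub_zero,
    Real.coe_toNNReal _ hκ.le]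
  have h1 : (√(2 * Real.pi))⁻¹ = √(1 / (1 + p)) * (√(2 * Real.pi * (1 / (1 + p))))⁻¹ := by
    have h0 : √(1 / (1 + p)) ≠ 0 := (Real.sqrt_pos.2 hκ).ne'
    rw [Real.sqrt_mul (by positivity) (1 / (1 + p)), mul_inv, mul_left_comm, mul_inv_cancel₀ h0, mul_one]
  have h2 : Real.exp (-z ^ 2 / 2) * Real.exp (-(p * (v - z) ^ 2 / 2)) =
      Real.exp (-(p * v ^ 2 * (1 / (1 + p)) / 2)) *
        Real.exp (-(z - (1 - 1 / (1 + p)) * v) ^ 2 / (2 * (1 / (1 + p)))) := by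
    rw [← Real.exp_add, ← Real.exp_add]
    congr 1
    field_simp
    ring
  rw [h1]
  linear_combination (√(1 / (1 + p)) * (√(2 * Real.pi * (1 / (1 + p))))⁻¹ * f z) * h2

theorem integral_exp_gaussianReal {p : ℝ} (hp : 0 < p) (v : ℝ) :
    ∫ z, Real.exp (-(p * (v - z) ^ 2 / 2)) ∂gaussianReal 0 1 =
      √(1 / (1 + p)) * Real.exp (-(p * v ^ 2 * (1 / (1 + p)) / 2)) := by
  simpa using integral_exp_mul_gaussianReal hp v fun _ => 1

theorem integral_exp_mul_id_gaussianReal {p : ℝ} (hp : 0 < p) (v : ℝ) :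
    ∫ z, Real.exp (-(p * (v - z) ^ 2 / 2)) * z ∂gaussianReal 0 1 =
      √(1 / (1 + p)) * Real.exp (-(p * v ^ 2 * (1 / (1 + p)) / 2)) *
        ((1 - 1 / (1 + p)) * v) := by
  rw [integral_exp_mul_gaussianReal hp v fun z => z, integral_id_gaussianReal]

/-- Fubini for a product with one modified factor. -/
theorem integral_pi_prod_mul_eval {ι : Type*} [Fintype ι] [DecidableEq ι] {E : ι → Type*}
    [∀ i, MeasurableSpace (E i)] (μ : ∀ i, Measure (E i)) [∀ i, SigmaFinite (μ i)]
    (φ : ∀ i, E i → ℝ) (j : ι) (ψ : E j → ℝ) :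
    ∫ x, (∏ i, φ i (x i)) * ψ (x j) ∂Measure.pi μ =
      (∫ x, φ j x * ψ x ∂μ j) * ∏ i ∈ Finset.univ.erase j, ∫ x, φ i x ∂μ i := by
  have h := integral_fintype_prod_eq_prod (𝕜 := ℝ) (μ := μ)
    (Function.update φ j fun x => φ j x * ψ x)
  rw [← Finset.mul_prod_erase _ _ (Finset.mem_univ j), Function.update_self] at h
  have hl : ∀ x : ∀ i, E i, (∏ i, φ i (x i)) * ψ (x j) =
      ∏ i, Function.update φ j (fun x => φ j x * ψ x) i (x i) := by
    intro x
    rw [← Finset.mul_prod_erase _ _ (Finset.mem_univ j),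
      ← Finset.mul_prod_erase Finset.univ
        (fun i => Function.update φ j (fun x => φ j x * ψ x) i (x i)) (Finset.mem_univ j),
      Function.update_self, mul_right_comm]
    congr 1
    refine Finset.prod_congr rfl fun i hi => ?_
    rw [Function.update_of_ne (Finset.ne_of_mem_erase hi)]
  simp_rw [hl]
  rw [h]
  congr 1
  refine Finset.prod_congr rfl fun i hi => ?_
  rw [Function.update_of_ne (Finset.ne_of_mem_erase hi)]

variable {k : ℕ}

theorem integral_stdGaussian_eq_pi (f : EuclideanSpace ℝ (Fin k) → ℝ) :
    ∫ z, f z ∂stdGaussian (EuclideanSpace ℝ (Fin k)) =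
      ∫ x, f (WithLp.toLp 2 x) ∂Measure.pi fun _ : Fin k => gaussianReal 0 1 := by
  rw [← map_pi_eq_stdGaussian,
    ← MeasurableEquiv.coe_toLp, integral_map_equiv]

theorem exp_norm_sub_sq_eq_prod (p : ℝ) (v : EuclideanSpace ℝ (Fin k)) (x : Fin k → ℝ) :
    Real.exp (-(p * ‖v - WithLp.toLp 2 x‖ ^ 2 / 2)) =
      ∏ i, Real.exp (-(p * (v i - x i) ^ 2 / 2)) := by
  rw [← Real.exp_sum, EuclideanSpace.real_norm_sq_eq]
  simp [Finset.mul_sum, Finset.sum_div]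

theorem prod_gaussian_factor (p : ℝ) (v : EuclideanSpace ℝ (Fin k)) :
    ∏ i, (√(1 / (1 + p)) * Real.exp (-(p * v i ^ 2 * (1 / (1 + p)) / 2))) =
      √(1 / (1 + p)) ^ k * Real.exp (-(p * ‖v‖ ^ 2 * (1 / (1 + p)) / 2)) := by
  rw [Finset.prod_mul_distrib, ← Real.exp_sum, EuclideanSpace.real_norm_sq_eq]
  simp [Finset.mul_sum, Finset.sum_div, Finset.sum_mul]

theorem integral_exp_stdGaussian {p : ℝ} (hp : 0 < p) (v : EuclideanSpace ℝ (Fin k)) :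
    ∫ z, Real.exp (-(p * ‖v - z‖ ^ 2 / 2)) ∂stdGaussian (EuclideanSpace ℝ (Fin k)) =
      √(1 / (1 + p)) ^ k * Real.exp (-(p * ‖v‖ ^ 2 * (1 / (1 + p)) / 2)) := by
  rw [integral_stdGaussian_eq_pi]
  simp_rw [exp_norm_sub_sq_eq_prod]
  rw [integral_fintype_prod_eq_prod (𝕜 := ℝ)
    (f := fun i x => Real.exp (-(p * (v i - x) ^ 2 / 2)))]
  simp_rw [integral_exp_gaussianReal hp]
  exact prod_gaussian_factor p v

theorem integrable_exp_smul_stdGaussian {p : ℝ} (hp : 0 ≤ p) (v : EuclideanSpace ℝ (Fin k)) :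
    Integrable (fun z => Real.exp (-(p * ‖v - z‖ ^ 2 / 2)) • z)
      (stdGaussian (EuclideanSpace ℝ (Fin k))) := by
  have hmeas : Measurable fun z : EuclideanSpace ℝ (Fin k) =>
      Real.exp (-(p * ‖v - z‖ ^ 2 / 2)) := by fun_prop
  refine Integrable.bdd_smul IsGaussian.integrable_fun_id 1 hmeas.aestronglyMeasurable
    (ae_of_all _ fun z => ?_)
  rw [Real.norm_of_nonneg (Real.exp_pos _).le, Real.exp_le_one_iff]
  have : 0 ≤ p * ‖v - z‖ ^ 2 / 2 := by positivity
  linarith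

theorem integral_exp_smul_stdGaussian {p : ℝ} (hp : 0 < p) (v : EuclideanSpace ℝ (Fin k)) :
    ∫ z, Real.exp (-(p * ‖v - z‖ ^ 2 / 2)) • z ∂stdGaussian (EuclideanSpace ℝ (Fin k)) =
      (√(1 / (1 + p)) ^ k * Real.exp (-(p * ‖v‖ ^ 2 * (1 / (1 + p)) / 2)) *
        (1 - 1 / (1 + p))) • v := by
  have hint := integrable_exp_smul_stdGaussian hp.le v
  ext j
  have h1 := (EuclideanSpace.proj (𝕜 := ℝ) j).integral_comp_comm hint
  simp only [PiLp.proj_apply, PiLp.smul_apply, smul_eq_mul] at h1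
  rw [← h1, integral_stdGaussian_eq_pi, PiLp.smul_apply, smul_eq_mul]
  simp_rw [exp_norm_sub_sq_eq_prod]
  rw [integral_pi_prod_mul_eval (fun _ : Fin k => gaussianReal 0 1)
    (fun i x => Real.exp (-(p * (v i - x) ^ 2 / 2))) j (fun x => x)]
  simp_rw [integral_exp_gaussianReal hp]
  rw [integral_exp_mul_id_gaussianReal hp, ← prod_gaussian_factor,
    ← Finset.mul_prod_erase Finset.univ _ (Finset.mem_univ j)]
  ring

/-- The likelihood of one group, centred at the least squares estimate. -/
noncomputable def groupLikelihood (N : Matrix (Fin k) (Fin k) ℝ) (σ : ℝ) (b : Fin k → ℝ)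
    (β : EuclideanSpace ℝ (Fin k)) : ℝ :=
  Real.exp (-((b - WithLp.ofLp β) ⬝ᵥ N *ᵥ (b - WithLp.ofLp β) / (2 * σ ^ 2)))

theorem measurable_groupLikelihood (N : Matrix (Fin k) (Fin k) ℝ) (σ : ℝ) (b : Fin k → ℝ) :
    Measurable (groupLikelihood N σ b) := by
  unfold groupLikelihood
  simp only [dotProduct, Matrix.mulVec]
  fun_prop

theorem groupLikelihood_le_one {N : Matrix (Fin k) (Fin k) ℝ} (hN : N.PosSemidef) (σ : ℝ)
    (b : Fin k → ℝ) (β : EuclideanSpace ℝ (Fin k)) : groupLikelihood N σ b β ≤ 1 := by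
  have h := hN.dotProduct_mulVec_nonneg (b - WithLp.ofLp β)
  rw [star_trivial] at h
  rw [groupLikelihood, Real.exp_le_one_iff]
  have : 0 ≤ (b - WithLp.ofLp β) ⬝ᵥ N *ᵥ (b - WithLp.ofLp β) / (2 * σ ^ 2) := by positivity
  linarith

variable {N : Matrix (Fin k) (Fin k) ℝ} {σ τ t : ℝ}

/-- In the coordinates `β = T z` with `T ^ 2 = t σ² τ² N⁻¹`, the group likelihood is isotropic. -/
theorem exists_whitening (hN : N.PosDef) (hσ : 0 < σ) (hτ : 0 < τ) (ht : 0 < t)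
    (b : Fin k → ℝ) :
    ∃ (T : EuclideanSpace ℝ (Fin k) →L[ℝ] EuclideanSpace ℝ (Fin k))
      (v : EuclideanSpace ℝ (Fin k)),
      multivariateGaussian 0 ((t * σ ^ 2 * τ ^ 2) • N⁻¹) =
        (stdGaussian (EuclideanSpace ℝ (Fin k))).map T ∧
      T v = WithLp.toLp 2 b ∧
      t * τ ^ 2 * ‖v‖ ^ 2 = b ⬝ᵥ N *ᵥ b / σ ^ 2 ∧
      ∀ z, groupLikelihood N σ b (T z) = Real.exp (-(t * τ ^ 2 * ‖v - z‖ ^ 2 / 2)) := by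
  set w := t * σ ^ 2 * τ ^ 2 with hw
  have hw0 : 0 < w := by positivity
  have hdet : IsUnit N.det := hN.det_pos.ne'.isUnit
  set T := CFC.sqrt (w • N⁻¹) with hT
  have hTT : T * T = w • N⁻¹ :=
    CFC.sqrt_mul_sqrt_self _ (hN.inv.posSemidef.smul hw0.le).nonneg
  have hconj := sqrt_smul_inv_conj hdet hw0.ne' hTT
  have hTt : Tᵀ = T := transpose_sqrt _
  have hTdet : IsUnit T.det := by
    have h : IsUnit (T * T).det := by
      rw [hTT, Matrix.det_smul]
      exact ((pow_ne_zero _ hw0.ne').isUnit).mul (by simpa using hdet)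
    rw [Matrix.det_mul] at h
    exact isUnit_of_mul_isUnit_left h
  have hquad : ∀ x : Fin k → ℝ, (T *ᵥ x) ⬝ᵥ N *ᵥ (T *ᵥ x) = w * (x ⬝ᵥ x) := by
    intro x
    rw [dotProduct_comm, Matrix.dotProduct_mulVec, ← Matrix.mulVec_transpose, hTt,
      Matrix.mulVec_mulVec, Matrix.mulVec_mulVec, hconj, Matrix.smul_mulVec,
      Matrix.one_mulVec, smul_dotProduct, smul_eq_mul]
  have hTv : T *ᵥ (T⁻¹ *ᵥ b) = b := by
    rw [Matrix.mulVec_mulVec, Matrix.mul_nonsing_inv _ hTdet, Matrix.one_mulVec]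
  refine ⟨Matrix.toEuclideanCLM (𝕜 := ℝ) T, WithLp.toLp 2 (T⁻¹ *ᵥ b), ?_, ?_, ?_, fun z => ?_⟩
  · rw [multivariateGaussian, ← hT]
    simp
  · rw [Matrix.toEuclideanCLM_toLp, hTv]
  · rw [norm_sq_eq_dotProduct]
    have := hquad (T⁻¹ *ᵥ b)
    rw [hTv] at this
    rw [this, hw]
    field_simp
  · rw [groupLikelihood, Matrix.ofLp_toEuclideanCLM, norm_sq_eq_dotProduct]
    have h1 : b - T *ᵥ WithLp.ofLp z = T *ᵥ (T⁻¹ *ᵥ b - WithLp.ofLp z) := by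
      rw [Matrix.mulVec_sub, hTv]
    rw [h1, hquad, hw, WithLp.ofLp_sub]
    congr 2
    field_simp

/-- After whitening the precision is `p = tτ²`, so `1 / (1 + p)` is the shrinkage coefficient and
`p‖v‖²` is the group statistic. -/
theorem integral_groupLikelihood (hN : N.PosDef) (hσ : 0 < σ) (hτ : 0 < τ) (ht : 0 < t)
    (b : Fin k → ℝ) :
    ∫ β, groupLikelihood N σ b β ∂multivariateGaussian 0 ((t * σ ^ 2 * τ ^ 2) • N⁻¹) =
      groupMarginal τ (b ⬝ᵥ N *ᵥ b / σ ^ 2) k t := by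
  obtain ⟨T, v, hmap, -, hv, hlik⟩ := exists_whitening hN hσ hτ ht b
  rw [hmap, integral_map (by fun_prop)
    (measurable_groupLikelihood N σ b).aestronglyMeasurable]
  simp_rw [hlik]
  rw [integral_exp_stdGaussian (by positivity), hv]
  rfl

theorem integral_groupLikelihood_smul (hN : N.PosDef) (hσ : 0 < σ) (hτ : 0 < τ) (ht : 0 < t)
    (b : Fin k → ℝ) :
    ∫ β, groupLikelihood N σ b β • β ∂multivariateGaussian 0 ((t * σ ^ 2 * τ ^ 2) • N⁻¹) =
      (groupMarginal τ (b ⬝ᵥ N *ᵥ b / σ ^ 2) k t * (1 - shrinkCoef τ t)) •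
        WithLp.toLp 2 b := by
  obtain ⟨T, v, hmap, hTv, hv, hlik⟩ := exists_whitening hN hσ hτ ht b
  rw [hmap, integral_map (by fun_prop)
    (Measurable.aestronglyMeasurable (by have := measurable_groupLikelihood N σ b; fun_prop))]
  simp_rw [hlik, ← map_smul]
  rw [T.integral_comp_comm, integral_exp_smul_stdGaussian (by positivity), hv, map_smul, hTv]
  · rfl
  · exact integrable_exp_smul_stdGaussian (by positivity) v

end Gaussian

end GroupHT

namespace GroupHT

open scoped Matrix MatrixOrder

/-! ### Factorization of the posterior over groups. -/

section Posterior

variable {n G : ℕ} {m : Fin G → ℕ} {X : ∀ g, Matrix (Fin n) (Fin (m g)) ℝ} {σ τ : ℝ}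

/-- The factor of the likelihood that depends on the data only. -/
noncomputable def residualFactor (X : ∀ g, Matrix (Fin n) (Fin (m g)) ℝ) (σ : ℝ)
    (y : EuclideanSpace ℝ (Fin n)) : ℝ :=
  likelihood X σ y fun g => WithLp.toLp 2 (leastSquares X y g)

theorem residualFactor_pos (y : EuclideanSpace ℝ (Fin n)) : 0 < residualFactor X σ y :=
  Real.exp_pos _

theorem likelihood_eq_prod (hr : FullRank X) (hX : BlockOrthogonal X)
    (y : EuclideanSpace ℝ (Fin n)) (β : ∀ g, EuclideanSpace ℝ (Fin (m g))) :
    likelihood X σ y β = residualFactor X σ y *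
      ∏ g, groupLikelihood ((X g)ᵀ * X g) σ (leastSquares X y g) (β g) := by
  simp only [residualFactor, likelihood, groupLikelihood]
  rw [← Real.exp_sum, ← Real.exp_add, norm_sub_linearPredictor_sq hr hX y β]
  congr 1
  rw [Finset.sum_neg_distrib, ← Finset.sum_div]
  ring

theorem integral_likelihood (hn : n ≠ 0) (hr : FullRank X) (hX : BlockOrthogonal X)
    (hσ : 0 < σ) (hτ : 0 < τ) (y : EuclideanSpace ℝ (Fin n)) {l : Fin G → ℝ}
    (hl : ∀ g, 0 < l g) :
    ∫ β, likelihood X σ y β ∂coefPrior X σ τ l =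
      residualFactor X σ y * ∏ g, groupMarginal τ (groupStatistic X σ y g) (m g) (l g) := by
  simp_rw [likelihood_eq_prod hr hX, integral_const_mul, coefPrior]
  rw [integral_fintype_prod_eq_prod (𝕜 := ℝ)
    (f := fun g β => groupLikelihood ((X g)ᵀ * X g) σ (leastSquares X y g) β)]
  congr 1
  refine Finset.prod_congr rfl fun g _ => ?_
  rw [integral_groupLikelihood (posDef_transpose_mul_self (hr g)) hσ hτ (hl g),
    groupStatistic_eq hn]

theorem integral_likelihood_smul (hn : n ≠ 0) (hr : FullRank X) (hX : BlockOrthogonal X)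
    (hσ : 0 < σ) (hτ : 0 < τ) (y : EuclideanSpace ℝ (Fin n)) {l : Fin G → ℝ}
    (hl : ∀ g, 0 < l g) (g : Fin G) :
    ∫ β, likelihood X σ y β • β g ∂coefPrior X σ τ l =
      (residualFactor X σ y * ((∏ h, groupMarginal τ (groupStatistic X σ y h) (m h) (l h)) *
        (1 - kappa τ l g))) • WithLp.toLp 2 (leastSquares X y g) := by
  have hpd := fun h => posDef_transpose_mul_self (hr h)
  set φ : ∀ h, EuclideanSpace ℝ (Fin (m h)) → ℝ := fun h =>
    groupLikelihood ((X h)ᵀ * X h) σ (leastSquares X y h) with hφ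
  have hφm : ∀ h, Measurable (φ h) := fun h => measurable_groupLikelihood _ _ _
  have hφ1 : ∀ h β, |φ h β| ≤ 1 := fun h β => by
    have h0 : 0 < φ h β := Real.exp_pos _
    rw [abs_of_pos h0]
    exact groupLikelihood_le_one (hpd h).posSemidef _ _ _
  have hprodm : Measurable fun β : ∀ h, EuclideanSpace ℝ (Fin (m h)) => ∏ h, φ h (β h) :=
    Finset.measurable_prod _ fun h _ => (hφm h).comp (measurable_pi_apply h)
  have hint : Integrable (fun β : ∀ h, EuclideanSpace ℝ (Fin (m h)) =>
      (∏ h, φ h (β h)) • β g) (coefPrior X σ τ l) := by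
    refine Integrable.bdd_smul (integrable_comp_eval (f := fun x => x)
      IsGaussian.integrable_fun_id) 1 hprodm.aestronglyMeasurable (ae_of_all _ fun β => ?_)
    rw [Real.norm_eq_abs, Finset.abs_prod]
    exact Finset.prod_le_one (fun _ _ => abs_nonneg _) fun h _ => hφ1 h _
  have hint1 : Integrable (fun β => φ g β • β)
      (multivariateGaussian 0 ((l g * σ ^ 2 * τ ^ 2) • ((X g)ᵀ * X g)⁻¹)) :=
    Integrable.bdd_smul IsGaussian.integrable_fun_id 1 (hφm g).aestronglyMeasurable
      (ae_of_all _ fun β => hφ1 g β)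
  simp_rw [likelihood_eq_prod hr hX, mul_smul]
  rw [integral_smul]
  congr 1
  -- Vector-valued integrals are compared coordinatewise, so that scalar Fubini for products
  -- applies; integrability justifies moving the projections inside.
  ext j
  have h1 := (EuclideanSpace.proj (𝕜 := ℝ) j).integral_comp_comm hint
  have h2 := (EuclideanSpace.proj (𝕜 := ℝ) j).integral_comp_comm hint1
  simp only [PiLp.proj_apply, PiLp.smul_apply, smul_eq_mul] at h1 h2
  rw [integral_groupLikelihood_smul (hpd g) hσ hτ (hl g), ← groupStatistic_eq hn,
    PiLp.smul_apply, smul_eq_mul] at h2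
  rw [← h1, coefPrior, integral_pi_prod_mul_eval _ φ g (fun x => x j), h2]
  simp only [PiLp.smul_apply, smul_eq_mul]
  rw [← Finset.mul_prod_erase Finset.univ
    (fun h => groupMarginal τ (groupStatistic X σ y h) (m h) (l h)) (Finset.mem_univ g)]
  have h3 : ∏ i ∈ Finset.univ.erase g, ∫ x, φ i x ∂multivariateGaussian 0
      ((l i * σ ^ 2 * τ ^ 2) • ((X i)ᵀ * X i)⁻¹) =
      ∏ i ∈ Finset.univ.erase g, groupMarginal τ (groupStatistic X σ y i) (m i) (l i) := by
    refine Finset.prod_congr rfl fun i _ => ?_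
    rw [integral_groupLikelihood (hpd i) hσ hτ (hl i), groupStatistic_eq hn]
  rw [h3]
  rw [show kappa τ l g = shrinkCoef τ (l g) from rfl]
  ring

variable {a : ℝ} {L : ℝ → ℝ}

theorem ae_pi_localPrior_pos (hL : IsPolynomialTailed a L) :
    ∀ᵐ l ∂Measure.pi fun _ : Fin G => localPrior a L, ∀ g, 0 < l g := by
  have := isProbabilityMeasure_localPrior hL
  refine eventually_all.2 fun g => ?_
  exact Measure.tendsto_eval_ae_ae.eventually (ae_pos_localPrior (a := a) (L := L))

/-- The factor of group `g` is kept apart so that all others, and the residual factor, cancel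
against the numerator of the weight. -/
theorem bayesIntegral_one (hL : IsPolynomialTailed a L) (hn : n ≠ 0) (hr : FullRank X)
    (hX : BlockOrthogonal X) (hσ : 0 < σ) (hτ : 0 < τ) (y : EuclideanSpace ℝ (Fin n))
    (g : Fin G) :
    bayesIntegral a L X σ τ y (fun _ _ => (1 : ℝ)) = residualFactor X σ y *
      ((∫ t, groupMarginal τ (groupStatistic X σ y g) (m g) t ∂localPrior a L) *
        ∏ h ∈ Finset.univ.erase g,
          ∫ t, groupMarginal τ (groupStatistic X σ y h) (m h) t ∂localPrior a L) := by
  have := isProbabilityMeasure_localPrior hL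
  rw [Finset.mul_prod_erase Finset.univ (fun h =>
      ∫ t, groupMarginal τ (groupStatistic X σ y h) (m h) t ∂localPrior a L) (Finset.mem_univ g),
    ← integral_fintype_prod_eq_prod (𝕜 := ℝ), ← integral_const_mul, bayesIntegral]
  refine integral_congr_ae ?_
  filter_upwards [ae_pi_localPrior_pos hL] with l hl
  simp only [smul_eq_mul, mul_one]
  exact integral_likelihood hn hr hX hσ hτ y hl

theorem integral_pi_weight (hL : IsPolynomialTailed a L) (y : EuclideanSpace ℝ (Fin n))
    (g : Fin G) :
    ∫ l : Fin G → ℝ, residualFactor X σ y *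
      ((∏ h, groupMarginal τ (groupStatistic X σ y h) (m h) (l h)) * (1 - kappa τ l g))
        ∂(Measure.pi fun _ : Fin G => localPrior a L) = residualFactor X σ y *
      ((∫ t, groupMarginal τ (groupStatistic X σ y g) (m g) t * (1 - shrinkCoef τ t)
          ∂localPrior a L) *
        ∏ h ∈ Finset.univ.erase g,
          ∫ t, groupMarginal τ (groupStatistic X σ y h) (m h) t ∂localPrior a L) := by
  have := isProbabilityMeasure_localPrior hL
  rw [integral_const_mul]
  congr 1
  exact integral_pi_prod_mul_eval (fun _ : Fin G => localPrior a L)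
    (fun h => groupMarginal τ (groupStatistic X σ y h) (m h)) g (fun t => 1 - shrinkCoef τ t)

theorem bayesIntegral_one_sub_kappa (hL : IsPolynomialTailed a L) (hn : n ≠ 0)
    (hr : FullRank X) (hX : BlockOrthogonal X) (hσ : 0 < σ) (hτ : 0 < τ)
    (y : EuclideanSpace ℝ (Fin n)) (g : Fin G) :
    bayesIntegral a L X σ τ y (fun l _ => 1 - kappa τ l g) = residualFactor X σ y *
      ((∫ t, groupMarginal τ (groupStatistic X σ y g) (m g) t * (1 - shrinkCoef τ t)
          ∂localPrior a L) *
        ∏ h ∈ Finset.univ.erase g,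
          ∫ t, groupMarginal τ (groupStatistic X σ y h) (m h) t ∂localPrior a L) := by
  rw [← integral_pi_weight hL y g, bayesIntegral]
  refine integral_congr_ae ?_
  filter_upwards [ae_pi_localPrior_pos hL] with l hl
  simp only [smul_eq_mul]
  rw [integral_mul_const, integral_likelihood hn hr hX hσ hτ y hl, mul_assoc]

/-- Given the local parameters, the posterior mean of `β_g` is `(1-κ_g)` times the least squares
estimate, which is free of those parameters and comes out of the outer integral. -/
theorem bayesIntegral_coef (hL : IsPolynomialTailed a L) (hn : n ≠ 0)
    (hr : FullRank X) (hX : BlockOrthogonal X) (hσ : 0 < σ) (hτ : 0 < τ)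
    (y : EuclideanSpace ℝ (Fin n)) (g : Fin G) :
    bayesIntegral a L X σ τ y (fun _ β => β g) =
      bayesIntegral a L X σ τ y (fun l _ => 1 - kappa τ l g) •
        WithLp.toLp 2 (leastSquares X y g) := by
  rw [bayesIntegral_one_sub_kappa hL hn hr hX hσ hτ, ← integral_pi_weight hL y g,
    ← integral_smul_const, bayesIntegral]
  refine integral_congr_ae ?_
  filter_upwards [ae_pi_localPrior_pos hL] with l hl
  exact integral_likelihood_smul hn hr hX hσ hτ y hl g

/-- The posterior shrinkage weight of a group depends on the data through its statistic only. -/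
theorem shrinkageWeight_eq_groupWeight (hL : IsPolynomialTailed a L) (hn : n ≠ 0)
    (hr : FullRank X) (hX : BlockOrthogonal X) (hσ : 0 < σ) (hτ : 0 < τ)
    (y : EuclideanSpace ℝ (Fin n)) (g : Fin G) :
    shrinkageWeight a L X σ τ y g =
      groupWeight (localPrior a L) τ (groupStatistic X σ y g) (m g) := by
  have := isProbabilityMeasure_localPrior hL
  have hpos := fun h => integral_groupMarginal_pos (τ := τ) (k := m h)
    (ae_pos_localPrior (a := a) (L := L)) (groupStatistic_nonneg hn hr σ y h)
  rw [shrinkageWeight, posteriorExp, bayesIntegral_one hL hn hr hX hσ hτ y g,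
    bayesIntegral_one_sub_kappa hL hn hr hX hσ hτ, groupWeight, smul_eq_mul]
  have h1 := (residualFactor_pos (X := X) (σ := σ) y).ne'
  have h2 := (hpos g).ne'
  have h3 := (Finset.prod_pos fun h (_ : h ∈ Finset.univ.erase g) => hpos h).ne'
  field_simp

theorem posteriorMean_eq_smul (hL : IsPolynomialTailed a L) (hn : n ≠ 0)
    (hr : FullRank X) (hX : BlockOrthogonal X) (hσ : 0 < σ) (hτ : 0 < τ)
    (y : EuclideanSpace ℝ (Fin n)) (g : Fin G) :
    posteriorMean a L X σ τ y g =
      shrinkageWeight a L X σ τ y g • WithLp.toLp 2 (leastSquares X y g) := by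
  rw [posteriorMean, posteriorExp, bayesIntegral_coef hL hn hr hX hσ hτ, shrinkageWeight,
    posteriorExp, smul_smul, smul_eq_mul]

/-- A positive statistic excludes a vanishing least squares estimate. This is what passes from
declared groups to groups with nonzero estimates. -/
theorem posteriorMean_ne_zero (hL : IsPolynomialTailed a L) (hn : n ≠ 0)
    (hr : FullRank X) (hX : BlockOrthogonal X) (hσ : 0 < σ) (hτ : 0 < τ)
    {y : EuclideanSpace ℝ (Fin n)} {g : Fin G} (hw : 0 < shrinkageWeight a L X σ τ y g)
    (hS : 0 < groupStatistic X σ y g) : posteriorMean a L X σ τ y g ≠ 0 := by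
  rw [posteriorMean_eq_smul hL hn hr hX hσ hτ]
  refine smul_ne_zero hw.ne' fun h => hS.ne' ?_
  have h0 : leastSquares X y g = 0 := by simpa using h
  rw [groupStatistic, h0]
  simp

end Posterior

end GroupHT

namespace GroupHT

open scoped Matrix MatrixOrder

/-! ### Projections of standard Gaussians and chi-square tails. -/

section GaussianTail

variable {n k : ℕ}

/-- `Aᵀ` is an isometry, and the characteristic function of a standard Gaussian depends only on the
norm of its argument. -/
theorem map_mulVec_stdGaussian (A : Matrix (Fin k) (Fin n) ℝ) (hA : A * Aᵀ = 1) :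
    (stdGaussian (EuclideanSpace ℝ (Fin n))).map
      (fun x => (WithLp.toLp 2 (A *ᵥ WithLp.ofLp x) : EuclideanSpace ℝ (Fin k))) =
      stdGaussian (EuclideanSpace ℝ (Fin k)) := by
  have hm : Measurable fun x : EuclideanSpace ℝ (Fin n) =>
      (WithLp.toLp 2 (A *ᵥ WithLp.ofLp x) : EuclideanSpace ℝ (Fin k)) :=
    (Continuous.measurable (by fun_prop))
  have := Measure.isProbabilityMeasure_map (μ := stdGaussian (EuclideanSpace ℝ (Fin n)))
    hm.aemeasurable
  apply Measure.ext_of_charFun (E := EuclideanSpace ℝ (Fin k))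
  ext t
  have h1 : ∀ x : EuclideanSpace ℝ (Fin n),
      inner ℝ (WithLp.toLp 2 (A *ᵥ WithLp.ofLp x) : EuclideanSpace ℝ (Fin k)) t =
        inner ℝ x (WithLp.toLp 2 (Aᵀ *ᵥ WithLp.ofLp t)) := by
    intro x
    simp only [EuclideanSpace.inner_eq_star_dotProduct, star_trivial]
    rw [Matrix.dotProduct_mulVec, ← Matrix.mulVec_transpose]
  have h2 : ‖(WithLp.toLp 2 (Aᵀ *ᵥ WithLp.ofLp t) : EuclideanSpace ℝ (Fin n))‖ ^ 2 =
      ‖t‖ ^ 2 := by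
    rw [norm_sq_eq_dotProduct, norm_sq_eq_dotProduct, Matrix.dotProduct_mulVec,
      ← Matrix.mulVec_transpose, Matrix.transpose_transpose, Matrix.mulVec_mulVec, hA,
      Matrix.one_mulVec]
  rw [charFun_apply, integral_map hm.aemeasurable
    (Measurable.aestronglyMeasurable (by fun_prop))]
  simp_rw [h1]
  rw [← charFun_apply, charFun_stdGaussian, charFun_stdGaussian]
  norm_cast
  rw [h2]

theorem integrable_exp_mul_sq_gaussianReal {θ : ℝ} (hθ : θ < 1 / 2) :
    Integrable (fun z => Real.exp (θ * z ^ 2)) (gaussianReal 0 1) := by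
  rw [gaussianReal_of_var_ne_zero _ one_ne_zero,
    integrable_withDensity_iff (measurable_gaussianPDF 0 1) (by simp [gaussianPDF])]
  have h := ((integrable_exp_neg_mul_sq (b := 1 / 2 - θ) (by linarith)).const_mul
    (√(2 * Real.pi))⁻¹)
  refine h.congr (ae_of_all _ fun z => ?_)
  simp only [toReal_gaussianPDF, gaussianPDFReal, NNReal.coe_one, mul_one, sub_zero]
  rw [mul_left_comm, ← Real.exp_add]
  congr 2
  ring

theorem integral_exp_mul_sq_gaussianReal {θ : ℝ} (hθ : θ < 1 / 2) :
    ∫ z, Real.exp (θ * z ^ 2) ∂gaussianReal 0 1 = √(1 / (1 - 2 * θ)) := by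
  rw [integral_gaussianReal_eq_integral_smul one_ne_zero]
  have h : ∀ z : ℝ, gaussianPDFReal 0 1 z • Real.exp (θ * z ^ 2) =
      (√(2 * Real.pi))⁻¹ * Real.exp (-(1 / 2 - θ) * z ^ 2) := by
    intro z
    simp only [gaussianPDFReal, NNReal.coe_one, mul_one, sub_zero, smul_eq_mul]
    rw [mul_assoc, ← Real.exp_add]
    congr 2
    ring
  simp_rw [h]
  have h3 : 0 < 1 - 2 * θ := by linarith
  rw [integral_const_mul, integral_gaussian, ← Real.sqrt_inv, ← Real.sqrt_mul (by positivity)]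
  congr 1
  have := Real.pi_pos
  have h2 : 0 < 1 / 2 - θ := by linarith
  field_simp

theorem exp_mul_norm_sq_eq_prod (θ : ℝ) (x : Fin k → ℝ) :
    Real.exp (θ * ‖(WithLp.toLp 2 x : EuclideanSpace ℝ (Fin k))‖ ^ 2) =
      ∏ i, Real.exp (θ * x i ^ 2) := by
  rw [← Real.exp_sum, EuclideanSpace.real_norm_sq_eq, Finset.mul_sum]

/-- Chernoff's bound with the chi-square moment generating function, a product over coordinates that
is finite for `θ < 1/2`. -/
theorem stdGaussian_real_norm_sq_ge_le {θ : ℝ} (hθ0 : 0 ≤ θ) (hθ : θ < 1 / 2) (u : ℝ) :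
    (stdGaussian (EuclideanSpace ℝ (Fin k))).real {z | u ≤ ‖z‖ ^ 2} ≤
      Real.exp (-θ * u) * √(1 / (1 - 2 * θ)) ^ k := by
  have hint : Integrable (fun z => Real.exp (θ * ‖z‖ ^ 2))
      (stdGaussian (EuclideanSpace ℝ (Fin k))) := by
    rw [← map_pi_eq_stdGaussian, ← MeasurableEquiv.coe_toLp, integrable_map_equiv]
    have h := Integrable.fintype_prod (μ := fun _ : Fin k => gaussianReal 0 1)
      (f := fun _ x => Real.exp (θ * x ^ 2)) fun _ => integrable_exp_mul_sq_gaussianReal hθ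
    refine h.congr (ae_of_all _ fun x => ?_)
    exact (exp_mul_norm_sq_eq_prod θ x).symm
  have h := measure_ge_le_exp_mul_mgf (X := fun z : EuclideanSpace ℝ (Fin k) => ‖z‖ ^ 2)
    (μ := stdGaussian (EuclideanSpace ℝ (Fin k))) u hθ0 hint
  refine h.trans_eq ?_
  congr 1
  rw [mgf, integral_stdGaussian_eq_pi]
  simp_rw [exp_mul_norm_sq_eq_prod]
  rw [integral_fintype_prod_eq_prod (𝕜 := ℝ) (f := fun _ x => Real.exp (θ * x ^ 2)),
    integral_exp_mul_sq_gaussianReal hθ]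
  simp

end GaussianTail

/-! ### Noise scores under the data law. -/

section Noise

variable {n G : ℕ} {m : Fin G → ℕ} {X : ∀ g, Matrix (Fin n) (Fin (m g)) ℝ} {σ : ℝ}
  {β0 : ∀ g, EuclideanSpace ℝ (Fin (m g))}

/-- The standardized score of the noise `y - X β0` in group `g`. -/
noncomputable def noiseScore (X : ∀ g, Matrix (Fin n) (Fin (m g)) ℝ) (σ : ℝ)
    (β0 : ∀ g, EuclideanSpace ℝ (Fin (m g))) (g : Fin G) (y : EuclideanSpace ℝ (Fin n)) :
    EuclideanSpace ℝ (Fin (m g)) :=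
  standardScore X σ g (y - linearPredictor X β0)

theorem measurable_noiseScore (g : Fin G) : Measurable (noiseScore X σ β0 g) := by
  unfold noiseScore standardScore
  exact Continuous.measurable (by fun_prop)

instance isProbabilityMeasure_dataLaw : IsProbabilityMeasure (dataLaw X σ β0) := by
  unfold dataLaw; infer_instance

/-- The noise is `W z` with `W² = σ² I` and `z` standard Gaussian, and `σ⁻¹ R W` has orthonormal
rows because `R` does. -/
theorem map_noiseScore_dataLaw (hr : FullRank X) (hσ : 0 < σ) (g : Fin G) :
    (dataLaw X σ β0).map (noiseScore X σ β0 g) =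
      stdGaussian (EuclideanSpace ℝ (Fin (m g))) := by
  set W := CFC.sqrt (σ ^ 2 • (1 : Matrix (Fin n) (Fin n) ℝ)) with hW
  have hWW : W * W = σ ^ 2 • (1 : Matrix (Fin n) (Fin n) ℝ) :=
    CFC.sqrt_mul_sqrt_self _ (Matrix.PosSemidef.one.smul (sq_nonneg σ)).nonneg
  have hWt : Wᵀ = W := transpose_sqrt _
  set R := CFC.sqrt ((X g)ᵀ * X g)⁻¹ * (X g)ᵀ with hR
  rw [dataLaw, multivariateGaussian, ← hW,
    Measure.map_map (measurable_noiseScore g) (by fun_prop),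
    ← map_mulVec_stdGaussian ((σ⁻¹ • R) * W)]
  · congr 1
    ext1 x
    simp only [Function.comp_apply, noiseScore, add_sub_cancel_left, standardScore,
      Matrix.ofLp_toEuclideanCLM, Matrix.mulVec_mulVec]
    rfl
  · rw [Matrix.transpose_mul, hWt, Matrix.transpose_smul,
      show (σ⁻¹ • R) * W * (W * σ⁻¹ • Rᵀ) = (σ⁻¹ • R) * (W * W) * (σ⁻¹ • Rᵀ) by
        simp only [Matrix.mul_assoc], hWW]
    simp only [Matrix.smul_mul, Matrix.mul_smul, Matrix.mul_one, smul_smul]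
    rw [hR, sqrt_gram_inv_orthonormal hr]
    rw [show σ⁻¹ * (σ ^ 2 * σ⁻¹) = 1 by field_simp, one_smul]

theorem dataLaw_real_noise_ge_le (hr : FullRank X) (hσ : 0 < σ) {s : ℕ} (hs : ∀ g, m g ≤ s)
    {θ : ℝ} (hθ0 : 0 ≤ θ) (hθ : θ < 1 / 2) (u : ℝ) (g : Fin G) :
    (dataLaw X σ β0).real {y | u ≤ ‖noiseScore X σ β0 g y‖ ^ 2} ≤
      Real.exp (-θ * u) * √(1 / (1 - 2 * θ)) ^ s := by
  have h := stdGaussian_real_norm_sq_ge_le (k := m g) hθ0 hθ u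
  rw [← map_noiseScore_dataLaw (β0 := β0) hr hσ g, map_measureReal_apply
    (measurable_noiseScore g) (measurableSet_le measurable_const (by fun_prop))] at h
  refine h.trans (mul_le_mul_of_nonneg_left ?_ (Real.exp_pos _).le)
  -- The base is at least 1 since `θ ≥ 0`, so replacing the group size by `s` only enlarges the
  -- bound.
  refine pow_le_pow_right₀ ?_ (hs g)
  rw [Real.one_le_sqrt, le_div_iff₀ (by linarith)]
  linarith

theorem dataLaw_real_exists_noise_ge_le (hr : FullRank X) (hσ : 0 < σ) {s : ℕ}
    (hs : ∀ g, m g ≤ s) {θ : ℝ} (hθ0 : 0 ≤ θ) (hθ : θ < 1 / 2) (u : ℝ) :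
    (dataLaw X σ β0).real {y | ∃ g, u ≤ ‖noiseScore X σ β0 g y‖ ^ 2} ≤
      G * (Real.exp (-θ * u) * √(1 / (1 - 2 * θ)) ^ s) := by
  have h : {y | ∃ g, u ≤ ‖noiseScore X σ β0 g y‖ ^ 2} =
      ⋃ g, {y | u ≤ ‖noiseScore X σ β0 g y‖ ^ 2} := by
    ext y; simp
  rw [h]
  calc _ ≤ ∑ g, (dataLaw X σ β0).real {y | u ≤ ‖noiseScore X σ β0 g y‖ ^ 2} :=
        measureReal_iUnion_fintype_le _
    _ ≤ ∑ _ : Fin G, (Real.exp (-θ * u) * √(1 / (1 - 2 * θ)) ^ s) :=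
        Finset.sum_le_sum fun g _ => dataLaw_real_noise_ge_le hr hσ hs hθ0 hθ u g
    _ = _ := by simp

open Classical in
-- Markov's inequality for the number of exceedances, whose mean is a sum of the one-group tails.
theorem dataLaw_real_count_noise_ge_le (hr : FullRank X) (hσ : 0 < σ) {s : ℕ}
    (hs : ∀ g, m g ≤ s) {θ : ℝ} (hθ0 : 0 ≤ θ) (hθ : θ < 1 / 2) (u : ℝ) {R : ℝ} (hR : 0 < R) :
    (dataLaw X σ β0).real
        {y | R ≤ ∑ g, if u ≤ ‖noiseScore X σ β0 g y‖ ^ 2 then (1 : ℝ) else 0} ≤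
      G * (Real.exp (-θ * u) * √(1 / (1 - 2 * θ)) ^ s) / R := by
  have hset : ∀ g, MeasurableSet {y | u ≤ ‖noiseScore X σ β0 g y‖ ^ 2} := fun g =>
    measurableSet_le measurable_const ((measurable_noiseScore g).norm.pow_const 2)
  have hind : ∀ g, (fun y => if u ≤ ‖noiseScore X σ β0 g y‖ ^ 2 then (1 : ℝ) else 0) =
      Set.indicator {y | u ≤ ‖noiseScore X σ β0 g y‖ ^ 2} 1 := by
    intro g; ext y; simp [Set.indicator_apply]
  have hint : ∀ g, Integrable
      (fun y => if u ≤ ‖noiseScore X σ β0 g y‖ ^ 2 then (1 : ℝ) else 0) (dataLaw X σ β0) := by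
    intro g
    rw [hind]
    exact (integrable_const (1 : ℝ)).indicator (hset g)
  have h := mul_meas_ge_le_integral_of_nonneg (μ := dataLaw X σ β0)
    (f := fun y => ∑ g, if u ≤ ‖noiseScore X σ β0 g y‖ ^ 2 then (1 : ℝ) else 0)
    (ae_of_all _ fun y => Finset.sum_nonneg fun g _ => by split_ifs <;> norm_num)
    (integrable_finsetSum _ fun g _ => hint g) R
  rw [le_div_iff₀ hR, mul_comm]
  refine h.trans ?_
  rw [integral_finsetSum _ fun g _ => hint g]
  calc _ ≤ ∑ _ : Fin G, (Real.exp (-θ * u) * √(1 / (1 - 2 * θ)) ^ s) := by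
        refine Finset.sum_le_sum fun g _ => ?_
        rw [hind, integral_indicator_one (hset g)]
        exact dataLaw_real_noise_ge_le hr hσ hs hθ0 hθ u g
    _ = _ := by simp

end Noise

end GroupHT

namespace GroupHT

open scoped Matrix

/-! ### Deterministic control of the estimate of `τ` and of the selected groups. -/

section Selection

variable {n G : ℕ} {m : Fin G → ℕ} {X : ∀ g, Matrix (Fin n) (Fin (m g)) ℝ} {σ c₁ c₂ : ℝ}
  {β0 : ∀ g, EuclideanSpace ℝ (Fin (m g))} {y : EuclideanSpace ℝ (Fin n)}

theorem standardScore_eq_signal_add_noise (g : Fin G) :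
    standardScore X σ g y =
      standardScore X σ g (linearPredictor X β0) + noiseScore X σ β0 g y := by
  rw [noiseScore, ← standardScore_add, add_sub_cancel]

theorem groupStatistic_of_inactive (hn : n ≠ 0) (hr : FullRank X) (hX : BlockOrthogonal X)
    {g : Fin G} (hg : g ∉ activeSet β0) :
    groupStatistic X σ y g = ‖noiseScore X σ β0 g y‖ ^ 2 := by
  have hβ : β0 g = 0 := not_not.1 hg
  rw [groupStatistic_eq_norm_sq hn hr, standardScore_eq_signal_add_noise (β0 := β0),
    standardScore_linearPredictor_of_eq_zero hn hr hX σ hβ, zero_add]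

theorem le_groupStatistic_of_signal (hn : n ≠ 0) (hr : FullRank X) {g : Fin G} {D : ℝ}
    (hsig : D ^ 2 ≤ ‖standardScore X σ g (linearPredictor X β0)‖ ^ 2) (hD : 0 ≤ D)
    (hnoise : ‖noiseScore X σ β0 g y‖ ^ 2 ≤ (D / 2) ^ 2) :
    D ^ 2 / 4 ≤ groupStatistic X σ y g := by
  have h1 : D ≤ ‖standardScore X σ g (linearPredictor X β0)‖ :=
    le_of_sq_le_sq hsig (norm_nonneg _)
  have h2 : ‖noiseScore X σ β0 g y‖ ≤ D / 2 := le_of_sq_le_sq hnoise (by linarith)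
  have h3 : D / 2 ≤ ‖standardScore X σ g y‖ := by
    rw [standardScore_eq_signal_add_noise (β0 := β0)]
    have := norm_sub_le_norm_add (standardScore X σ g (linearPredictor X β0))
      (noiseScore X σ β0 g y)
    linarith
  rw [groupStatistic_eq_norm_sq hn hr]
  calc D ^ 2 / 4 = (D / 2) ^ 2 := by ring
    _ ≤ _ := pow_le_pow_left₀ (by linarith) h3 2

theorem inv_sq_le_tauEB : (1 / (G : ℝ)) ^ 2 ≤ tauEB X σ c₁ c₂ y :=
  pow_le_pow_left₀ (by positivity) (le_max_left _ _) 2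

theorem tauEB_pos (hG : 0 < G) : 0 < tauEB X σ c₁ c₂ y :=
  lt_of_lt_of_le (by positivity) inv_sq_le_tauEB

open Classical in
theorem tauEB_le_of_count_le (hG : 0 < G) (hc₂ : 1 ≤ c₂) {K : ℝ} (hK : 1 ≤ K)
    (h : ∑ g, (if c₁ * Real.log (G : ℝ) < groupStatistic X σ y g then (1 : ℝ) else 0) ≤ K) :
    tauEB X σ c₁ c₂ y ≤ (K / G) ^ 2 := by
  have hG' : (0 : ℝ) < G := Nat.cast_pos.2 hG
  refine pow_le_pow_left₀ (le_max_of_le_left (by positivity)) (max_le (by gcongr) ?_) 2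
  rw [one_div, mul_inv, div_eq_mul_inv, mul_assoc, mul_comm K]
  calc _ ≤ 1 * ((G : ℝ)⁻¹ * ∑ g, if c₁ * Real.log (G : ℝ) < groupStatistic X σ y g
        then (1 : ℝ) else 0) := by
        refine mul_le_mul_of_nonneg_right (inv_le_one_of_one_le₀ hc₂) ?_
        exact mul_nonneg (by positivity)
          (Finset.sum_nonneg fun g _ => by split_ifs <;> norm_num)
    _ ≤ _ := by rw [one_mul]; gcongr

open Classical in
theorem tauEB_le_one (hG : 0 < G) (hc₂ : 1 ≤ c₂) : tauEB X σ c₁ c₂ y ≤ 1 := by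
  have hG' : (0 : ℝ) < G := Nat.cast_pos.2 hG
  have h := tauEB_le_of_count_le (X := X) (σ := σ) (c₁ := c₁) (y := y) hG hc₂
    (K := G) (Nat.one_le_cast.2 hG) (by
      calc _ ≤ ∑ _ : Fin G, (1 : ℝ) :=
            Finset.sum_le_sum fun g _ => by split_ifs <;> norm_num
        _ = _ := by simp)
  rwa [div_self hG'.ne', one_pow] at h

open Classical in
-- Active groups are counted in full. In an inactive group the statistic is pure noise, and `c₁ ≥ 2`
-- allows the lower threshold `2 log G`.
theorem count_exceedances_le (hn : n ≠ 0) (hr : FullRank X) (hX : BlockOrthogonal X)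
    (hG : 0 < G) (hc₁ : 2 ≤ c₁) :
    ∑ g, (if c₁ * Real.log (G : ℝ) < groupStatistic X σ y g then (1 : ℝ) else 0) ≤
      (activeSet β0).ncard +
        ∑ g, if 2 * Real.log (G : ℝ) ≤ ‖noiseScore X σ β0 g y‖ ^ 2 then (1 : ℝ) else 0 := by
  have hlog : 0 ≤ Real.log (G : ℝ) := Real.log_nonneg (Nat.one_le_cast.2 hG)
  have hcard : ((activeSet β0).ncard : ℝ) = ∑ g, if g ∈ activeSet β0 then (1 : ℝ) else 0 := by
    rw [Set.ncard_eq_toFinset_card', Finset.sum_boole]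
    congr 2
    ext g; simp
  rw [hcard, ← Finset.sum_add_distrib]
  refine Finset.sum_le_sum fun g _ => ?_
  by_cases hg : g ∈ activeSet β0
  · rw [if_pos hg]
    split_ifs <;> norm_num
  · rw [if_neg hg, zero_add, groupStatistic_of_inactive (β0 := β0) hn hr hX hg]
    split_ifs with h1 h2 h2
    · exact le_rfl
    · exact absurd ((mul_le_mul_of_nonneg_right hc₁ hlog).trans h1.le) h2
    · norm_num
    · exact le_rfl

variable {a : ℝ} {L : ℝ → ℝ}

open Classical in
/-- Deterministic selection consistency, given bounds on the noise and on the weights. -/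
theorem selection_eq_activeSet (hL : IsPolynomialTailed a L) (ha : 0 ≤ a) (hσ : 0 < σ)
    (hc₁ : 2 ≤ c₁) (hc₂ : 1 ≤ c₂) (hn : n ≠ 0) (hr : FullRank X) (hX : BlockOrthogonal X)
    (hG : 0 < G) {s : ℕ} (hs : ∀ g, m g ≤ s) {θ Cu Cl u D K : ℝ} (hθ : 0 < θ) (hCu : 0 < Cu)
    (hCl : 0 < Cl) (hD : 0 < D) (hK : 1 ≤ K)
    (hup : ∀ (k : ℕ) (τ S : ℝ), k ≤ s → 0 < τ → τ ≤ 1 → 0 ≤ S →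
      groupWeight (localPrior a L) τ S k ≤ Cu * (Real.exp (S / 2) * (τ ^ 2) ^ θ))
    (hlow : ∀ (k : ℕ) (τ S : ℝ), k ≤ s → 0 < τ → τ ≤ 1 → 0 ≤ S →
      3 / 4 - Cl * (Real.exp (-(S / 16)) * (τ ^ 2) ^ (-a)) ≤
        groupWeight (localPrior a L) τ S k)
    (hsig : ∀ g ∈ activeSet β0, D ^ 2 ≤ ‖standardScore X σ g (linearPredictor X β0)‖ ^ 2)
    (huD : u ≤ (D / 2) ^ 2)
    (hnum_up : Cu * (Real.exp (u / 2) * ((((K + (activeSet β0).ncard) / G) ^ 2) ^ 2) ^ θ) ≤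
      1 / 2)
    (hnum_low : Cl * (Real.exp (-(D ^ 2 / 4 / 16)) * (((1 / (G : ℝ)) ^ 2) ^ 2) ^ (-a)) < 1 / 4)
    (hnoise : ∀ g, ‖noiseScore X σ β0 g y‖ ^ 2 < u)
    (hcount : ∑ g, (if 2 * Real.log (G : ℝ) ≤ ‖noiseScore X σ β0 g y‖ ^ 2 then (1 : ℝ) else 0)
      < K) :
    declaredActive a L X σ c₁ c₂ y = activeSet β0 ∧
      selectedSet a L X σ c₁ c₂ y = activeSet β0 := by
  have hG' : (0 : ℝ) < G := Nat.cast_pos.2 hG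
  set τ := tauEB X σ c₁ c₂ y with hτdef
  have hτ0 : 0 < τ := tauEB_pos hG
  have hτ1 : τ ≤ 1 := tauEB_le_one hG hc₂
  have hτlow : (1 / (G : ℝ)) ^ 2 ≤ τ := inv_sq_le_tauEB
  have hτup : τ ≤ ((K + (activeSet β0).ncard) / G) ^ 2 := by
    refine tauEB_le_of_count_le hG hc₂ (by
      have : (0 : ℝ) ≤ (activeSet β0).ncard := Nat.cast_nonneg _
      linarith) ?_
    have := count_exceedances_le (β0 := β0) (σ := σ) (y := y) hn hr hX hG hc₁
    linarith
  have hS0 := groupStatistic_nonneg hn hr σ y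
  have hw : ∀ g, shrinkageWeight a L X σ τ y g =
      groupWeight (localPrior a L) τ (groupStatistic X σ y g) (m g) :=
    fun g => shrinkageWeight_eq_groupWeight hL hn hr hX hσ hτ0 y g
  have hact : ∀ g ∈ activeSet β0, D ^ 2 / 4 ≤ groupStatistic X σ y g := fun g hg =>
    le_groupStatistic_of_signal hn hr (hsig g hg) hD.le ((hnoise g).le.trans huD)
  have hdecl : declaredActive a L X σ c₁ c₂ y = activeSet β0 := by
    ext g
    change 1 / 2 < shrinkageWeight a L X σ τ y g ↔ g ∈ activeSet β0
    rw [hw]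
    constructor
    · intro h
      by_contra hg
      have hS : groupStatistic X σ y g ≤ u := by
        rw [groupStatistic_of_inactive (β0 := β0) hn hr hX hg]
        exact (hnoise g).le
      have h1 := hup (m g) τ _ (hs g) hτ0 hτ1 (hS0 g)
      have h2 : Cu * (Real.exp (groupStatistic X σ y g / 2) * (τ ^ 2) ^ θ) ≤
          Cu * (Real.exp (u / 2) * ((((K + (activeSet β0).ncard) / G) ^ 2) ^ 2) ^ θ) := by
        gcongr
      linarith
    · intro hg
      have h1 := hlow (m g) τ _ (hs g) hτ0 hτ1 (hS0 g)
      have h2 : Cl * (Real.exp (-(groupStatistic X σ y g / 16)) * (τ ^ 2) ^ (-a)) ≤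
          Cl * (Real.exp (-(D ^ 2 / 4 / 16)) * (((1 / (G : ℝ)) ^ 2) ^ 2) ^ (-a)) := by
        refine mul_le_mul_of_nonneg_left (mul_le_mul ?_ ?_ (by positivity) (by positivity))
          hCl.le
        · have := hact g hg
          exact Real.exp_le_exp.2 (by linarith)
        -- The exponent is not positive, so the floor `1/G` on the square root of the estimate
        -- bounds this factor from above.
        · exact Real.rpow_le_rpow_of_nonpos (by positivity)
            (pow_le_pow_left₀ (by positivity) hτlow 2) (by linarith)
      linarith
  refine ⟨hdecl, ?_⟩
  ext g
  rw [← hdecl]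
  change htEstimator a L X σ c₁ c₂ y g ≠ 0 ↔ _
  unfold htEstimator
  by_cases hg : g ∈ declaredActive a L X σ c₁ c₂ y
  · rw [if_pos hg]
    refine iff_of_true (posteriorMean_ne_zero hL hn hr hX hσ hτ0 ?_ ?_) hg
    · have : 1 / 2 < shrinkageWeight a L X σ τ y g := hg
      linarith
    · refine lt_of_lt_of_le ?_ (hact g (hdecl ▸ hg))
      positivity
  · rw [if_neg hg]
    simp [hg]

end Selection

/-! ### Limits of the deterministic bounds. -/

section Asymptotics

/-- Only subadditivity of the outer measure is used, so the selection events need not be shown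
measurable. -/
theorem tendsto_measure_one_of_compl_subset {Ω : ℕ → Type*} {mΩ : ∀ n, MeasurableSpace (Ω n)}
    (μ : ∀ n, Measure (Ω n)) [∀ n, IsProbabilityMeasure (μ n)] (S B : ∀ n, Set (Ω n))
    (b : ℕ → ℝ) (hSB : ∀ᶠ n in atTop, (S n)ᶜ ⊆ B n)
    (hB : ∀ᶠ n in atTop, (μ n).real (B n) ≤ b n) (hb : Tendsto b atTop (𝓝 0)) :
    Tendsto (fun n => μ n (S n)) atTop (𝓝 1) := by
  have h1 : Tendsto (fun n => 1 - ENNReal.ofReal (b n)) atTop (𝓝 1) := by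
    have h := ENNReal.Tendsto.sub (tendsto_const_nhds (x := (1 : ENNReal)) (f := atTop (α := ℕ)))
      (ENNReal.tendsto_ofReal hb) (Or.inl ENNReal.one_ne_top)
    simpa using h
  refine tendsto_of_tendsto_of_tendsto_of_le_of_le' h1 tendsto_const_nhds ?_
    (Eventually.of_forall fun n => prob_le_one)
  filter_upwards [hSB, hB] with n hn hbn
  rw [tsub_le_iff_right]
  calc (1 : ENNReal) = μ n Set.univ := measure_univ.symm
    _ = μ n (S n ∪ (S n)ᶜ) := by rw [Set.union_compl_self]
    _ ≤ μ n (S n) + μ n (S n)ᶜ := measure_union_le _ _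
    _ ≤ μ n (S n) + ENNReal.ofReal (b n) := by
        gcongr
        refine (measure_mono hn).trans ?_
        rw [← ofReal_measureReal]
        exact ENNReal.ofReal_le_ofReal hbn

/-- Exceedance thresholds proportional to `log x` turn Chernoff bounds into powers of `x`. -/
theorem exp_mul_log {x : ℝ} (hx : 0 < x) (c : ℝ) : Real.exp (c * Real.log x) = x ^ c := by
  rw [Real.rpow_def_of_pos hx, mul_comm]

theorem tendsto_const_mul_rpow_of_neg {x : ℕ → ℝ} (hx : Tendsto x atTop atTop) {r : ℝ}
    (hr : r < 0) (C : ℝ) : Tendsto (fun n => C * x n ^ r) atTop (𝓝 0) := by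
  have h := ((tendsto_rpow_neg_atTop (y := -r) (by linarith)).comp hx).const_mul C
  simpa using h

/-- With `K` of order `x ^ e`, the upper weight bound vanishes once `1 + δ / 2 < 4 θ (1 - e)`. -/
theorem tendsto_upper_weight {x N : ℕ → ℝ} (hx : Tendsto x atTop atTop) {e d θ B C : ℝ}
    (hθ : 0 < θ) (hd : d < 4 * θ * (1 - e)) (hN0 : ∀ n, 0 ≤ N n)
    (hN : ∀ᶠ n in atTop, N n ≤ B * x n ^ e) (hC : 0 ≤ C) :
    Tendsto (fun n => C * (Real.exp (2 * d * Real.log (x n) / 2) *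
      ((((x n ^ e + N n) / x n) ^ 2) ^ 2) ^ θ)) atTop (𝓝 0) := by
  have hlim := tendsto_const_mul_rpow_of_neg hx (r := d - 4 * θ * (1 - e)) (by linarith)
    (C * ((1 + B) ^ (4 : ℕ)) ^ θ)
  refine squeeze_zero' ?_ ?_ hlim
  · exact Eventually.of_forall fun n => by positivity
  · filter_upwards [hN, hx.eventually_gt_atTop 0] with n hn hx0
    have hxe : 0 < x n ^ e := Real.rpow_pos_of_pos hx0 _
    have hB : 0 ≤ 1 + B := by
      have : 0 ≤ B := le_of_mul_le_mul_right (by simpa using (hN0 n).trans hn) hxe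
      linarith
    have h1 : (x n ^ e + N n) / x n ≤ (1 + B) * x n ^ (e - 1) := by
      rw [Real.rpow_sub_one hx0.ne', ← mul_div_assoc]
      gcongr
      linarith
    have h0 : 0 ≤ (x n ^ e + N n) / x n := div_nonneg (add_nonneg hxe.le (hN0 n)) hx0.le
    -- The ratio bounds the square root of `τ`, hence its fourth power bounds `τ²`: this is the 4 in
    -- `4θ(1-e)`.
    have h2 : ((((x n ^ e + N n) / x n) ^ 2) ^ 2) ^ θ ≤
        ((1 + B) ^ (4 : ℕ)) ^ θ * x n ^ (4 * θ * (e - 1)) := by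
      calc _ ≤ ((((1 + B) * x n ^ (e - 1)) ^ 2) ^ 2) ^ θ := by gcongr
        _ = ((1 + B) ^ (4 : ℕ) * x n ^ (4 * (e - 1))) ^ θ := by
            rw [← pow_mul, mul_pow, ← Real.rpow_mul_natCast hx0.le]
            norm_num [mul_comm]
        _ = _ := by
            rw [Real.mul_rpow (by positivity) (by positivity), ← Real.rpow_mul hx0.le]
            congr 2; ring
    calc _ ≤ C * (x n ^ d * (((1 + B) ^ (4 : ℕ)) ^ θ * x n ^ (4 * θ * (e - 1)))) := by
          rw [show 2 * d * Real.log (x n) / 2 = d * Real.log (x n) by ring, exp_mul_log hx0]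
          gcongr
      _ = C * ((1 + B) ^ (4 : ℕ)) ^ θ * (x n ^ d * x n ^ (4 * θ * (e - 1))) := by ring
      _ = _ := by
          rw [← Real.rpow_add hx0]
          congr 2; ring

/-- The last factor is `x^(4a) ≤ n^(4a) = (n^r)^(4a/r)`, a power of `n^r`, which `exp(-c n^r)`
overwhelms. -/
theorem tendsto_lower_weight {x : ℕ → ℝ} (hx0 : ∀ᶠ n in atTop, 0 < x n)
    (hxn : ∀ n : ℕ, x n ≤ n) {r c a C : ℝ} (hr : 0 < r) (hc : 0 < c) (ha : 0 ≤ a) (hC : 0 ≤ C) :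
    Tendsto (fun n : ℕ => C * (Real.exp (-(c * (n : ℝ) ^ r)) * (((1 / x n) ^ 2) ^ 2) ^ (-a)))
      atTop (𝓝 0) := by
  have h := ((tendsto_rpow_mul_exp_neg_mul_atTop_nhds_zero (4 * a / r) c hc).comp
    ((tendsto_rpow_atTop hr).comp tendsto_natCast_atTop_atTop)).const_mul C
  rw [mul_zero] at h
  refine squeeze_zero' ?_ ?_ h
  · exact Eventually.of_forall fun n => by positivity
  · filter_upwards [hx0] with n hn
    have hn0 : (0 : ℝ) < n := hn.trans_le (hxn n)
    have h1 : (((1 / x n) ^ 2) ^ 2) ^ (-a) ≤ ((n : ℝ) ^ r) ^ (4 * a / r) := by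
      rw [← Real.rpow_mul hn0.le, mul_div_cancel₀ _ hr.ne', ← pow_mul, one_div, inv_pow,
        Real.inv_rpow (by positivity), Real.rpow_neg (by positivity), inv_inv,
        ← Real.rpow_natCast_mul hn.le]
      norm_num
      exact Real.rpow_le_rpow hn.le (hxn n) (by positivity)
    simp only [Function.comp_apply]
    rw [mul_comm (((n : ℝ) ^ r) ^ (4 * a / r)), neg_mul]
    gcongr

theorem eventually_log_le_rpow {x : ℕ → ℝ} (hx0 : ∀ᶠ n in atTop, 0 < x n)
    (hxn : ∀ n : ℕ, x n ≤ n) {r c d : ℝ} (hr : 0 < r) (hc : 0 < c) (hd : 0 < d) :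
    ∀ᶠ n : ℕ in atTop, d * Real.log (x n) ≤ c * (n : ℝ) ^ r := by
  have h := ((isLittleO_log_rpow_atTop hr).bound (c := c / d) (by positivity))
  filter_upwards [tendsto_natCast_atTop_atTop.eventually h, hx0] with n hn hx
  have h1 : Real.log (x n) ≤ Real.log n := Real.log_le_log hx (hxn n)
  have h2 : Real.log (n : ℝ) ≤ c / d * (n : ℝ) ^ r := by
    refine (le_abs_self _).trans (hn.trans_eq ?_)
    rw [Real.norm_of_nonneg (by positivity)]
  calc d * Real.log (x n) ≤ d * (c / d * (n : ℝ) ^ r) := by gcongr; linarith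
    _ = _ := by field_simp

end Asymptotics

end GroupHT

/-! ### Probability of the bad event and choice of the exponents. -/

namespace GroupHT

/-- Up to the constant `M`, the two terms are `x^(1-2ηd)` and `x^(1-2η-e)`. -/
theorem tendsto_noise_bound {x : ℕ → ℝ} (hx : Tendsto x atTop atTop) {d e η M : ℝ}
    (h1 : 1 < η * (2 * d)) (h2 : 1 < 2 * η + e) :
    Tendsto (fun n => x n * (Real.exp (-η * (2 * d * Real.log (x n))) * M) +
      x n * (Real.exp (-η * (2 * Real.log (x n))) * M) / x n ^ e) atTop (𝓝 0) := by
  have hl := (tendsto_const_mul_rpow_of_neg hx (r := 1 - η * (2 * d)) (by linarith) M).add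
    (tendsto_const_mul_rpow_of_neg hx (r := 1 - (2 * η + e)) (by linarith) M)
  rw [add_zero] at hl
  refine hl.congr' ?_
  filter_upwards [hx.eventually_gt_atTop 0] with n hn
  have e1 : -η * (2 * d * Real.log (x n)) = -(η * (2 * d)) * Real.log (x n) := by ring
  have e2 : -η * (2 * Real.log (x n)) = -(2 * η) * Real.log (x n) := by ring
  rw [e1, e2, exp_mul_log hn, exp_mul_log hn,
    show 1 - η * (2 * d) = 1 + -(η * (2 * d)) by ring,
    show 1 - (2 * η + e) = 1 + -(2 * η) - e by ring, Real.rpow_sub hn, Real.rpow_add hn,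
    Real.rpow_add hn, Real.rpow_one]
  ring

/-- Since `e < 1/2`, some `θ < 1/2 ≤ a` has `4θ(1-e) > 1`, leaving room for `d > 1` below that
value. As `d > 1` and `e > 0`, both conditions on `η` then hold for `η` close enough to `1/2`. -/
theorem exists_tuning {a ε : ℝ} (ha : 1 / 2 ≤ a) (hε : ε < 1 / 2) :
    ∃ e θ d η : ℝ, ε < e ∧ 0 < θ ∧ θ < a ∧ θ ≤ 1 ∧ d < 4 * θ * (1 - e) ∧
      0 ≤ η ∧ η < 1 / 2 ∧ 0 < d ∧ 1 < η * (2 * d) ∧ 1 < 2 * η + e ∧ 0 < e := by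
  obtain ⟨e, he, he2⟩ := exists_between (max_lt hε (by norm_num : (0 : ℝ) < 1 / 2))
  have he1 : ε < e := (le_max_left _ _).trans_lt he
  have he0 : 0 < e := (le_max_right _ _).trans_lt he
  have h1e : 0 < 1 - e := by linarith
  obtain ⟨θ, hθ1, hθ2⟩ := exists_between (show 1 / (4 * (1 - e)) < 1 / 2 by
    rw [div_lt_div_iff₀ (by linarith) (by norm_num)]; linarith)
  have hθ0 : 0 < θ := lt_trans (by positivity) hθ1
  rw [div_lt_iff₀ (by linarith)] at hθ1
  obtain ⟨d, hd1, hd2⟩ := exists_between (show 1 < 4 * θ * (1 - e) by linarith)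
  obtain ⟨η, hη1, hη2⟩ := exists_between (max_lt (show 1 / (2 * d) < 1 / 2 by
    rw [div_lt_div_iff₀ (by linarith) (by norm_num)]; linarith)
    (show (1 - e) / 2 < 1 / 2 by linarith))
  have hη3 := (le_max_left _ _).trans_lt hη1
  have hη4 := (le_max_right _ _).trans_lt hη1
  rw [div_lt_iff₀ (by linarith)] at hη3
  exact ⟨e, θ, d, η, he1, hθ0, by linarith, by linarith, hd2, by linarith, hη2, by linarith,
    hη3, by linarith, he0⟩

end GroupHT

/-! ### Assembly of the theorem. -/

theorem theorem5
    -- the local prior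
    (a : ℝ) (ha : 1 / 2 ≤ a) (L : ℝ → ℝ)
    (hL : GroupHT.IsPolynomialTailed a L) (hL1 : GroupHT.SatisfiesAssumption1 L)
    -- the known error standard deviation and the constants of the estimate of `τ`
    (σ : ℝ) (hσ : 0 < σ) (c₁ c₂ : ℝ) (hc₁ : 2 ≤ c₁) (hc₂ : 1 ≤ c₂)
    -- for each sample size `n`: number of groups, group sizes, design, true coefficients
    (G : ℕ → ℕ) (m : ∀ n, Fin (G n) → ℕ)
    (X : ∀ n, ∀ g : Fin (G n), Matrix (Fin n) (Fin (m n g)) ℝ)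
    (β0 : ∀ n, ∀ g : Fin (G n), EuclideanSpace ℝ (Fin (m n g)))
    (hm : ∀ n g, 0 < m n g)
    (hGn : ∀ n, G n ≤ n)
    (hG : Tendsto G atTop atTop)
    (hrank : ∀ n, GroupHT.FullRank (X n))
    (horth : ∀ n, GroupHT.BlockOrthogonal (X n))
    -- (A1)
    (hA1 : ∃ C₁ : ℝ, 0 < C₁ ∧ ∀ n, ∀ g ∈ GroupHT.activeSet (β0 n),
      C₁ < GroupHT.minEigenvalue (GroupHT.gramQ_isHermitian (X n) g))
    -- (A2)
    (hA2 : ∃ b : ℝ, 0 ≤ b ∧ b < 1 / 2 ∧ ∃ C : ℝ, 0 < C ∧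
      ∀ n, ∀ g ∈ GroupHT.activeSet (β0 n), ∀ j, C * (n : ℝ) ^ (-b) < |β0 n g j|)
    -- (A3)
    (hA3 : ∃ s : ℕ, ∀ n g, m n g ≤ s)
    -- the sparsity condition
    (ε : ℝ) (hε0 : 0 < ε) (hε : ε < 1 / 2)
    (hsparse : (fun n => ((GroupHT.activeSet (β0 n)).ncard : ℝ)) =O[atTop]
      fun n => (G n : ℝ) ^ ε) :
    Tendsto (fun n => GroupHT.dataLaw (X n) σ (β0 n)
        {y | GroupHT.selectedSet a L (X n) σ c₁ c₂ y = GroupHT.activeSet (β0 n)})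
      atTop (𝓝 1) ∧
    Tendsto (fun n => GroupHT.dataLaw (X n) σ (β0 n)
        {y | GroupHT.declaredActive a L (X n) σ c₁ c₂ y = GroupHT.activeSet (β0 n)})
      atTop (𝓝 1) := by
  classical
  obtain ⟨C₁, hC₁, hA1⟩ := hA1
  obtain ⟨b, hb0, hb, C, hC, hA2⟩ := hA2
  obtain ⟨s, hs⟩ := hA3
  obtain ⟨e, θ, d, η, hεe, hθ0, hθa, hθ1, hdθ, hη0, hη, hd0, hηd, hηe, he0⟩ :=
    GroupHT.exists_tuning ha hε
  have hprior := GroupHT.isProbabilityMeasure_localPrior hL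
  have hpos := GroupHT.ae_pos_localPrior (a := a) (L := L)
  obtain ⟨Cu, hCu, hup⟩ := GroupHT.exists_groupWeight_le hpos hθ0 hθ1
    (GroupHT.integrable_rpow_localPrior hL hL1 hθ0 hθa) s
  obtain ⟨c, hc, T, -, hT⟩ := GroupHT.exists_localPrior_Icc_ge hL hL1 (by linarith)
  obtain ⟨Cl, hCl, hlow⟩ := GroupHT.exists_le_groupWeight hpos hc hT s
  have hx : Tendsto (fun n => (G n : ℝ)) atTop atTop := tendsto_natCast_atTop_atTop.comp hG
  have hxn : ∀ n : ℕ, (G n : ℝ) ≤ n := fun n => Nat.cast_le.2 (hGn n)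
  have hx0 : ∀ᶠ n in atTop, (0 : ℝ) < G n := hx.eventually_gt_atTop 0
  obtain ⟨B, hB0, hB⟩ := hsparse.exists_nonneg
  have hN : ∀ᶠ n in atTop, ((GroupHT.activeSet (β0 n)).ncard : ℝ) ≤ B * (G n : ℝ) ^ e := by
    filter_upwards [hB.bound, hx.eventually_ge_atTop 1] with n hn h1
    rw [Real.norm_of_nonneg (by positivity), Real.norm_of_nonneg (by positivity)] at hn
    exact hn.trans (mul_le_mul_of_nonneg_left
      (Real.rpow_le_rpow_of_exponent_le h1 hεe.le) hB0)
  -- By (A1) and (A2), every active group has squared signal at least `D² = c₀ n^(1-2b)`.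
  set c₀ := C₁ * C ^ 2 / σ ^ 2 with hc₀
  have hc₀0 : 0 < c₀ := by positivity
  have hr0 : 0 < 1 - 2 * b := by linarith
  have hup_lim := (GroupHT.tendsto_upper_weight hx hθ0 hdθ
    (fun n => Nat.cast_nonneg (GroupHT.activeSet (β0 n)).ncard) hN hCu.le).eventually_le_const
    (show (0 : ℝ) < 1 / 2 by norm_num)
  -- `64 = 4 * 16`: the statistic is at least `D²/4`, and the lower weight bound decays like
  -- `exp(-S/16)`.
  have hlow_lim := (GroupHT.tendsto_lower_weight hx0 hxn hr0 (c := c₀ / 64) (by positivity)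
    (show 0 ≤ a by linarith) hCl.le).eventually_lt_const (show (0 : ℝ) < 1 / 4 by norm_num)
  -- The noise threshold eventually lies below `(D/2)²`, so noise cannot cancel more than half of
  -- the signal.
  have hlog := GroupHT.eventually_log_le_rpow hx0 hxn hr0 (c := c₀ / 4) (by positivity)
    (show 0 < 2 * d by positivity)
  set bad : ∀ n, Set (EuclideanSpace ℝ (Fin n)) := fun n =>
    {y | ∃ g, 2 * d * Real.log (G n) ≤ ‖GroupHT.noiseScore (X n) σ (β0 n) g y‖ ^ 2} ∪
    {y | (G n : ℝ) ^ e ≤ ∑ g, if 2 * Real.log (G n) ≤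
      ‖GroupHT.noiseScore (X n) σ (β0 n) g y‖ ^ 2 then (1 : ℝ) else 0} with hbad
  have hgood : ∀ᶠ n in atTop, ∀ y, y ∉ bad n →
      GroupHT.declaredActive a L (X n) σ c₁ c₂ y = GroupHT.activeSet (β0 n) ∧
        GroupHT.selectedSet a L (X n) σ c₁ c₂ y = GroupHT.activeSet (β0 n) := by
    filter_upwards [hup_lim, hlow_lim, hlog, hx.eventually_ge_atTop 1] with n h1 h2 h3 h4 y hy
    have hG0 : 0 < G n := Nat.cast_pos.1 (one_pos.trans_le h4)
    have hn : n ≠ 0 := (hG0.trans_le (hGn n)).ne'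
    have hn0 : (0 : ℝ) < n := Nat.cast_pos.2 (Nat.pos_of_ne_zero hn)
    simp only [hbad, Set.mem_union, Set.mem_ofPred_eq, not_or, not_exists, not_le] at hy
    have hD : √(c₀ * (n : ℝ) ^ (1 - 2 * b)) ^ 2 = c₀ * (n : ℝ) ^ (1 - 2 * b) :=
      Real.sq_sqrt (by positivity)
    refine GroupHT.selection_eq_activeSet hL (by linarith) hσ hc₁ hc₂ hn (hrank n) (horth n) hG0
      (hs n) (D := √(c₀ * (n : ℝ) ^ (1 - 2 * b))) hθ0 hCu hCl (by positivity)
      (Real.one_le_rpow h4 he0.le) hup hlow (fun g hg => ?_) ?_ h1 ?_ hy.1 hy.2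
    · have h5 := GroupHT.le_norm_standardScore_linearPredictor_sq hn (hrank n) (horth n) σ
        (β := β0 n) (d := C * (n : ℝ) ^ (-b)) hC₁.le (by positivity) (hm n g) (hA1 n g hg).le
        (fun j => (hA2 n g hg j).le)
      rw [hD]
      refine le_trans (le_of_eq ?_) h5
      rw [hc₀, mul_pow, ← Real.rpow_mul_natCast hn0.le,
        show 1 - 2 * b = 1 + -b * (2 : ℕ) by push_cast; ring, Real.rpow_add hn0, Real.rpow_one]
      ring
    · rw [div_pow, hD]
      refine h3.trans (le_of_eq ?_)
      ring
    · rw [hD]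
      refine lt_of_eq_of_lt ?_ h2
      ring_nf
  have hprob : ∀ᶠ n in atTop, (GroupHT.dataLaw (X n) σ (β0 n)).real (bad n) ≤
      G n * (Real.exp (-η * (2 * d * Real.log (G n))) * √(1 / (1 - 2 * η)) ^ s) +
      G n * (Real.exp (-η * (2 * Real.log (G n))) * √(1 / (1 - 2 * η)) ^ s) /
        (G n : ℝ) ^ e := by
    filter_upwards [hx0] with n hn
    refine (measureReal_union_le _ _).trans (add_le_add ?_ ?_)
    · exact GroupHT.dataLaw_real_exists_noise_ge_le (hrank n) hσ (hs n) hη0 hη _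
    · exact GroupHT.dataLaw_real_count_noise_ge_le (hrank n) hσ (hs n) hη0 hη _
        (Real.rpow_pos_of_pos hn _)
  have hlim := GroupHT.tendsto_noise_bound hx (M := √(1 / (1 - 2 * η)) ^ s) hηd hηe
  refine ⟨GroupHT.tendsto_measure_one_of_compl_subset
      (fun n => GroupHT.dataLaw (X n) σ (β0 n)) _ bad _ ?_ hprob hlim,
    GroupHT.tendsto_measure_one_of_compl_subset
      (fun n => GroupHT.dataLaw (X n) σ (β0 n)) _ bad _ ?_ hprob hlim⟩
  · filter_upwards [hgood] with n hn y hy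
    by_contra h
    exact hy (hn y h).2
  · filter_upwards [hgood] with n hn y hy
    by_contra h
    exact hy (hn y h).1
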